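/- Let $2\le l\le d$. For $\mathbf x\in[0,\infty]^d$ let $x^{(p)}$ be its $p$-th largest component, and put $\mathbb E^{(p)}=\{\mathbf x\in[0,\infty]^d: x^{(p)}>0\}$ for $1\le p\le d$, $\mathbb E=\mathbb E^{(1)}$, and $\aleph^{(l)}=\{\mathbf x\in\mathbb E^{(l)}:x^{(l)}\ge 1\}$. For a locally compact Polish space $F$ let $M_+(F)$ be the set of nonnegative Radon measures on $F$ with the vague topology (generated by $\mu\mapsto\int f\,d\mu$, $f\ge0$ continuous with compact support), and write $\stackrel{v}{\to}$ for vague convergence. A law of a random vector $\mathbf U\in[0,\infty)^d$ is called regularly varying on $\mathbb E^{(p)}$ with scaling function $b$ and limit $\chi\in M_+(\mathbb E^{(p)})$, $\chi\neq0$, if $b$ is nondecreasing, $b(t)\to\infty$ and $tP[\mathbf U/b(t)\in\cdot\,]\stackrel{v}{\to}\chi$ in $M_+(\mathbb E^{(p)})$ as $t\to\infty$. Let $\mathbf Z_1,\mathbf Z_2,\dots$ be iid random vectors in $[0,\infty)^d$ with generic copy $\mathbf Z=(Z^1,\dots,Z^d)$. Assume: (a) (non-standard regular variation on $\mathbb E$)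 there are nondecreasing functions $a^j(t)\to\infty$, $1\le j\le d$, such that for some $\beta^j>0$, $tP[Z^j/a^j(t)\in\cdot\,]\stackrel{v}{\to}\nu_{\beta^j}$ in $M_+((0,\infty])$, where $\nu_{\beta}((x,\infty])=x^{-\beta}$ for $x>0$, and the vector $\mathbf U=(a^{j\leftarrow}(Z^j))_{1\le j\le d}$, with $a^{j\leftarrow}(x)=\inf\{s>0:a^j(s)\ge x\}$, is regularly varying on $\mathbb E$ with scaling function $t$ and some limit $\nu$; (b) (hidden regular variation on $\mathbb E^{(l)}$) $\mathbf U$ is regularly varying on $\mathbb E^{(l)}$ with some scaling function $b^{(l)}$ and limit $\nu^{(l)}$, and for some $1\le j<l$ it is regularly varying on $\mathbb E^{(j)}$ with some scaling function $b^{(j)}$ (where $b^{(1)}(t)=t$ if $j=1$) and limit $\nu^{(j)}$ such that $\nu^{(j)}(\mathbb E^{(l-1)})>0$, $\nu^{(j)}(\mathbb E^{(l)})=0$ and $b^{(j)}(t)/b^{(l)}(t)\to\infty$; (c) $\nu^{(l)}(\aleph^{(l)})=1$. Let $k=k(n)$ be positive integers with $k(n)\to\infty$ and $k(n)/n\to0$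 as $n\to\infty$. For a sample of size $n$ define the anti-ranks $r_i^j=\sum_{p=1}^n 1_{\{Z_p^j\ge Z_i^j\}}$, let $m_i^{(l)}$ be the $l$-th largest component of $(1/r_i^j)_{1\le j\le d}$, and let $m^{(l)}_{(1)}\ge\dots\ge m^{(l)}_{(n)}$ be the ordered values of $m^{(l)}_1,\dots,m^{(l)}_n$. Then, as $n\to\infty$, $$\hat\nu^{(l)}:=\frac1k\sum_{i=1}^n\epsilon_{\left((1/r_i^j)/m^{(l)}_{(k)},\,1\le j\le d\right)}\Rightarrow\nu^{(l)}\quad\text{in } M_+(\mathbb E^{(l)}),$$ where $\epsilon_{\mathbf x}$ is the unit point mass at $\mathbf x$ (restricted to $\mathbb E^{(l)}$) and $\Rightarrow$ denotes weak convergence of random elements of $M_+(\mathbb E^{(l)})$ (to the nonrandom limit $\nu^{(l)}$). -/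

import Mathlib

open MeasureTheory ProbabilityTheory Filter Topology Set
open scoped NNReal ENNReal

noncomputable section

/-! ### Order statistics and cones -/

/-- The `k`-th largest of the finitely many values `x i` (counted with multiplicity, `k = 1` being
the maximum): the largest threshold that at least `k` of the values reach. -/
def kthLargest {ι : Type*} [Fintype ι] (k : ℕ) (x : ι → ℝ≥0∞) : ℝ≥0∞ :=
  sSup {t | k ≤ (Finset.univ.filter fun i => t ≤ x i).card}

/-- If the values are already arranged in nonincreasing order, the `k`-th largest one stands in
the `k`-th place. -/
theorem kthLargest_of_antitone {n : ℕ} (x : Fin n → ℝ≥0∞) (hx : Antitone x) (i : Fin n) :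
    kthLargest (i + 1) x = x i := by
  apply le_antisymm
  · refine sSup_le fun t ht => ?_
    by_contra! hlt
    have hsub : (Finset.univ.filter fun p => t ≤ x p) ⊆ Finset.Iio i := by
      intro p hp
      simp only [Finset.mem_filter, Finset.mem_univ, true_and] at hp
      rw [Finset.mem_Iio]
      by_contra! hip
      exact absurd (hp.trans (hx hip)) (not_le.mpr hlt)
    have h1 := Finset.card_le_card hsub
    have h2 : (i : ℕ) + 1 ≤ _ := ht
    rw [Fin.card_Iio] at h1
    omega
  · refine le_sSup ?_
    have hsub : Finset.Iic i ⊆ (Finset.univ.filter fun p => x i ≤ x p) := by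
      intro p hp
      simpa using hx (Finset.mem_Iic.mp hp)
    have h1 := Finset.card_le_card hsub
    rw [Fin.card_Iic] at h1
    exact h1

/-- The `k`-th largest value does not depend on how the values are listed. -/
theorem kthLargest_comp_equiv {ι κ : Type*} [Fintype ι] [Fintype κ] (e : ι ≃ κ) (k : ℕ)
    (x : κ → ℝ≥0∞) : kthLargest k (x ∘ e) = kthLargest k x := by
  unfold kthLargest
  congr 1
  ext t
  have : (Finset.univ.filter fun i => t ≤ (x ∘ e) i).card
      = (Finset.univ.filter fun i => t ≤ x i).card :=
    Finset.card_equiv e (by simp)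
  simp only [mem_ofPred_eq, this]

/-- The cone `𝔼⁽ˡ⁾ = {x ∈ [0,∞]^d : x⁽ˡ⁾ > 0}`, where `x⁽ˡ⁾` is the `l`-th largest component. -/
def cone (d l : ℕ) : Set (Fin d → ℝ≥0∞) := {x | 0 < kthLargest l x}

/-- `𝔼⁽ˡ⁾` is the set of points with at least `l` positive components. -/
theorem mem_cone_iff {d l : ℕ} (x : Fin d → ℝ≥0∞) :
    x ∈ cone d l ↔ l ≤ (Finset.univ.filter fun j => 0 < x j).card := by
  constructor
  · intro h
    have h' : 0 < kthLargest l x := h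
    obtain ⟨t, ht, h0⟩ := lt_sSup_iff.mp h'
    refine le_trans ht (Finset.card_le_card fun j hj => ?_)
    simp only [Finset.mem_filter, Finset.mem_univ, true_and] at hj ⊢
    exact h0.trans_le hj
  · intro h
    set s := Finset.univ.filter fun j => 0 < x j with hs
    change 0 < kthLargest l x
    refine lt_sSup_iff.mpr ⟨s.inf x, ?_, ?_⟩
    · refine le_trans h (Finset.card_le_card fun j hj => ?_)
      simpa using Finset.inf_le hj
    · rw [Finset.lt_inf_iff ENNReal.zero_lt_top]
      intro j hj
      simpa [hs] using hj

theorem isOpen_cone (d l : ℕ) : IsOpen (cone d l) := by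
  have : cone d l = ⋃ s ∈ {s : Finset (Fin d) | l ≤ s.card}, {x | ∀ j ∈ s, 0 < x j} := by
    ext x
    simp only [mem_cone_iff, mem_iUnion, mem_ofPred_eq, exists_prop]
    constructor
    · intro h
      exact ⟨_, h, fun j hj => by simpa using hj⟩
    · rintro ⟨s, hs, hx⟩
      exact hs.trans (Finset.card_le_card fun j hj => by simpa using hx j hj)
  rw [this]
  refine isOpen_biUnion fun s _ => ?_
  have : {x : Fin d → ℝ≥0∞ | ∀ j ∈ s, 0 < x j} = ⋂ j ∈ s, {x | 0 < x j} := by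
    ext x; simp
  rw [this]
  exact isOpen_biInter_finset fun j _ => isOpen_lt continuous_const (continuous_apply j)

/-- The set `ℵ⁽ˡ⁾ = {x ∈ 𝔼⁽ˡ⁾ : x⁽ˡ⁾ ≥ 1}`. -/
def aleph (d l : ℕ) : Set (cone d l) := {x | 1 ≤ kthLargest l x.1}

/-! ### Radon measures and vague convergence -/

/-- `M₊(E)`: the nonnegative Borel measures on `E` that are finite on compact sets (for the locally
compact Polish spaces used below these are exactly the Radon measures). -/
def RadonMeasure (E : Type*) [TopologicalSpace E] [MeasurableSpace E] : Type _ :=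
  {μ : Measure E // IsFiniteMeasureOnCompacts μ}

/-- The vague topology on `M₊(E)`: the coarsest one for which `μ ↦ ∫ f dμ` is continuous for
every nonnegative continuous `f` with compact support. -/
instance RadonMeasure.instTopologicalSpace (E : Type*) [TopologicalSpace E] [MeasurableSpace E] :
    TopologicalSpace (RadonMeasure E) :=
  TopologicalSpace.induced
    (fun μ (f : CompactlySupportedContinuousMap E ℝ≥0) => ∫⁻ x, (f x : ℝ≥0∞) ∂μ.1) inferInstance

instance RadonMeasure.instMeasurableSpace (E : Type*) [TopologicalSpace E] [MeasurableSpace E] :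
    MeasurableSpace (RadonMeasure E) := borel _

instance RadonMeasure.instBorelSpace (E : Type*) [TopologicalSpace E] [MeasurableSpace E] :
    BorelSpace (RadonMeasure E) := ⟨rfl⟩

/-- The restriction of a finite measure on `X` to the subspace `C`, as an element of `M₊(C)`. -/
def traceOn {X : Type*} [TopologicalSpace X] [MeasurableSpace X] (C : Set X) (μ : Measure X)
    [IsFiniteMeasure μ] : RadonMeasure C :=
  ⟨μ.comap Subtype.val, inferInstance⟩

/-- The measure `β r^(-β-1) dr` on `(0, ∞)`, regarded as a measure on `[0, ∞]`. -/
def paretoBase (β : ℝ) : Measure ℝ≥0∞ :=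
  (((volume : Measure ℝ).restrict (Ioi 0)).withDensity
    fun r => ENNReal.ofReal (β * r ^ (-β - 1))).map ENNReal.ofReal

theorem paretoBase_Ioi {β : ℝ} (hβ : 0 < β) {x : ℝ} (hx : 0 < x) :
    paretoBase β (Ioi (ENNReal.ofReal x)) = ENNReal.ofReal (x ^ (-β)) := by
  have hpre : ENNReal.ofReal ⁻¹' (Ioi (ENNReal.ofReal x)) = Ioi x := by
    ext r
    simp only [mem_preimage, mem_Ioi]
    exact ENNReal.ofReal_lt_ofReal_iff'.trans
      ⟨fun h => h.1, fun h => ⟨h, hx.trans h⟩⟩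
  rw [paretoBase, Measure.map_apply ENNReal.measurable_ofReal measurableSet_Ioi, hpre,
    withDensity_apply _ measurableSet_Ioi, Measure.restrict_restrict measurableSet_Ioi,
    inter_eq_left.mpr (Ioi_subset_Ioi hx.le),
    ← ofReal_integral_eq_lintegral_ofReal]
  · rw [integral_const_mul, integral_Ioi_rpow_of_lt (by linarith) hx]
    congr 1
    have : -β - 1 + 1 = -β := by ring
    rw [this]
    field_simp
  · exact (integrableOn_Ioi_rpow_of_lt (by linarith) hx).const_mul β
  · filter_upwards [ae_restrict_mem measurableSet_Ioi] with r hr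
    have : 0 < r := hx.trans hr
    positivity

/-- The Pareto measure `ν_β` on `(0, ∞]`, with `ν_β((x, ∞]) = x^(-β)` for `x > 0`. -/
def paretoMeasure (β : ℝ) (hβ : 0 < β) : RadonMeasure (Ioi (0 : ℝ≥0∞)) :=
  ⟨(paretoBase β).comap Subtype.val, by
    constructor
    intro K hK
    rw [(MeasurableEmbedding.subtype_coe measurableSet_Ioi).comap_apply]
    obtain ⟨c, hc, hcK⟩ : ∃ c : ℝ, 0 < c ∧ Subtype.val '' K ⊆ Ioi (ENNReal.ofReal c) := by
      rcases K.eq_empty_or_nonempty with rfl | hne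
      · exact ⟨1, one_pos, by simp⟩
      · obtain ⟨m, -, hm⟩ := hK.exists_isMinOn hne continuous_subtype_val.continuousOn
        obtain ⟨c, hc0, hcm⟩ := ENNReal.lt_iff_exists_nnreal_btwn.mp m.2
        refine ⟨c, by exact_mod_cast hc0, ?_⟩
        rintro _ ⟨y, hy, rfl⟩
        rw [ENNReal.ofReal_coe_nnreal]
        exact lt_of_lt_of_le hcm (hm hy)
    refine lt_of_le_of_lt (measure_mono hcK) ?_
    rw [paretoBase_Ioi hβ hc]
    exact ENNReal.ofReal_lt_top⟩

/-! ### Regular variation, standardization, hidden regular variation -/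

/-- The random vector `U` with law `R` is regularly varying on `𝔼⁽ˡ⁾` with scaling function `b`
and limit measure `ν`: `b(t) ↑ ∞`, `ν ≠ 0`, and `t P[U / b(t) ∈ ·] → ν` vaguely on `𝔼⁽ˡ⁾`. -/
structure IsRegularlyVarying {d : ℕ} (l : ℕ) (R : Measure (Fin d → ℝ)) [IsFiniteMeasure R]
    (b : ℝ → ℝ) (ν : RadonMeasure (cone d l)) : Prop where
  monotone : MonotoneOn b (Ioi 0)
  tendsto_atTop : Tendsto b atTop atTop
  ne_zero : ν.1 ≠ 0
  vague : Tendsto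
    (fun t : ℝ => traceOn (cone d l)
      (t.toNNReal • R.map fun u (j : Fin d) => ENNReal.ofReal (u j / b t)))
    atTop (𝓝 ν)

/-- The left-continuous inverse `a←(x) = inf {s > 0 : a(s) ≥ x}`. -/
def leftInverse (a : ℝ → ℝ) (x : ℝ) : ℝ := sInf {s | 0 < s ∧ x ≤ a s}

/-- The marginal transformation `z ↦ (a¹←(z¹), …, aᵈ←(zᵈ))`. -/
def standardize {d : ℕ} (a : Fin d → ℝ → ℝ) (z : Fin d → ℝ≥0) : Fin d → ℝ :=
  fun j => leftInverse (a j) (z j)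

/-- Non-standard regular variation on `𝔼 = 𝔼⁽¹⁾` of the law `Q` of `Z`, with marginal scaling
functions `aʲ(t) ↑ ∞` and limit measure `ν`: the marginals satisfy
`t P[Zʲ / aʲ(t) ∈ ·] → ν_{βʲ}` vaguely on `(0, ∞]` for some `βʲ > 0`, and
`t P[(aʲ←(Zʲ) / t)_j ∈ ·] → ν` vaguely on `𝔼`. -/
structure IsNonstandardRegularlyVarying {d : ℕ} (Q : Measure (Fin d → ℝ≥0)) [IsFiniteMeasure Q]
    (a : Fin d → ℝ → ℝ) (ν : RadonMeasure (cone d 1)) : Prop where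
  monotone : ∀ j, MonotoneOn (a j) (Ioi 0)
  tendsto_atTop : ∀ j, Tendsto (a j) atTop atTop
  marginals : ∀ j, ∃ (β : ℝ) (hβ : 0 < β), Tendsto
    (fun t : ℝ => traceOn (Ioi (0 : ℝ≥0∞))
      (t.toNNReal • Q.map fun z => ENNReal.ofReal (z j / a j t)))
    atTop (𝓝 (paretoMeasure β hβ))
  standardized : IsRegularlyVarying 1 (Q.map (standardize a)) (fun t => t) ν

/-- Hidden regular variation on `𝔼⁽ˡ⁾` (non-standard case) of the law `Q` of `Z`, with scaling
function `bl` and limit measure `νl`. The vector `U = (aʲ←(Zʲ))_j` is regularly varying on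
`𝔼⁽ˡ⁾`, and it is regularly varying on some larger cone `𝔼⁽ʲ⁾`, `1 ≤ j < l`, with a limit measure
that charges `𝔼⁽ˡ⁻¹⁾` but not `𝔼⁽ˡ⁾` and a scaling function of larger order than `bl`; if `j = 1`
this scaling function is `t`. -/
structure HasHiddenRegularVariation {d : ℕ} (l : ℕ) (Q : Measure (Fin d → ℝ≥0))
    [IsFiniteMeasure Q] (a : Fin d → ℝ → ℝ) (bl : ℝ → ℝ) (νl : RadonMeasure (cone d l)) :
    Prop where
  regularlyVarying : IsRegularlyVarying l (Q.map (standardize a)) bl νl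
  hidden : ∃ (j : ℕ) (bj : ℝ → ℝ) (νj : RadonMeasure (cone d j)),
    1 ≤ j ∧ j < l ∧ (j = 1 → bj = fun t => t) ∧
    IsRegularlyVarying j (Q.map (standardize a)) bj νj ∧
    0 < νj.1 {x | x.1 ∈ cone d (l - 1)} ∧
    νj.1 {x | x.1 ∈ cone d l} = 0 ∧
    Tendsto (fun t => bj t / bl t) atTop atTop

/-! ### Anti-ranks and the rank-based estimator -/

/-- The anti-rank `r_i^j`: the number of `p` with `Z_p^j ≥ Z_i^j`. -/
def antiRank {d n : ℕ} (z : Fin n → Fin d → ℝ≥0) (i : Fin n) (j : Fin d) : ℕ :=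
  (Finset.univ.filter fun p => z i j ≤ z p j).card

/-- The vector `(1 / r_i^j)_j`. -/
def invRank {d n : ℕ} (z : Fin n → Fin d → ℝ≥0) (i : Fin n) : Fin d → ℝ≥0∞ :=
  fun j => (antiRank z i j : ℝ≥0∞)⁻¹

/-- `m⁽ˡ⁾_(k)`: the `k`-th largest among `m⁽ˡ⁾_i`, `i = 1, …, n`, where `m⁽ˡ⁾_i` is the `l`-th
largest component of `(1 / r_i^j)_j`. -/
def rankOrderStat {d n : ℕ} (l k : ℕ) (z : Fin n → Fin d → ℝ≥0) : ℝ≥0∞ :=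
  kthLargest k fun i => kthLargest l (invRank z i)

/-- The estimator `ν̂⁽ˡ⁾ = k⁻¹ ∑ᵢ ε_{((1 / r_i^j) / m⁽ˡ⁾_(k))_j}` as an element of `M₊(𝔼⁽ˡ⁾)`. -/
def rankEstimator {d n : ℕ} (l k : ℕ) (z : Fin n → Fin d → ℝ≥0) : RadonMeasure (cone d l) :=
  traceOn (cone d l)
    ((k : ℝ≥0)⁻¹ • ∑ i : Fin n, Measure.dirac fun j => invRank z i j / rankOrderStat l k z)

end

/-! Put `U = (aʲ←(Zʲ))_j`, `b = b⁽ˡ⁾` and `r_n = b(n/k)`. Hidden regular variation at time `t =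
n/k`, together with a Chebyshev law of large numbers, shows that `k⁻¹ ∑ ε_{U_i / r_n}` converges to
`ν⁽ˡ⁾` in probability (`tendsto_traceOn_pointMeasure_scaledPoint`).

Ranks replace the unknown `a` and `b`. Each component of `U` has tail asymptotic to `1/x`, so about
`(n/r_n)/y` sample points exceed `r_n y` in a given component. Hence `(n/r_n)/r_i^j` is close to
`U_i^j / r_n`, uniformly in `i` (`asympEq_scaledPoint_invRank`). This needs `n/r_n → ∞`, which
follows from `b(t)/t → 0`: the scaling function of the larger cone is `O(t)` (`exists_scaling_le`)
and dominates `b`. A uniformly small displacement of the points in the compact space `[0,∞]^d` does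
not change the vague limit (`tendsto_traceOn_pointMeasure_of_asympEq`).

The factor `n/r_n` is still unknown. The `k`-th largest value of the `l`-th largest component of the
rescaled points tends to `1`, because `x⁽ˡ⁾ ≥ 1` has limit mass one and the mass changes strictly on
both sides of that level (`tendsto_kthLargest_of_asympEq`). Strictness needs no homogeneity of
`ν⁽ˡ⁾`: a flat stretch would force `b` to grow at least linearly along a geometric sequence
(`one_lt_measure_le_kthLargest`). Dividing by this order statistic cancels `n/r_n` and leaves the
estimator. -/

/-! ### Convergence in probability as convergence along a filter; weak law of large numbers. -/

section ConvergenceInProbability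

variable {Ω : Type*} [MeasurableSpace Ω]

/-- The filter on `ℕ × Ω` whose sets are those with sections of asymptotically full (outer)
probability: `x ↦ X x.1 x.2` tends to `c` along it iff `X n` tends to `c` in probability. -/
def probFilter (P : Measure Ω) : Filter (ℕ × Ω) where
  sets := {S | Tendsto (fun n => P {ω | (n, ω) ∉ S}) atTop (𝓝 0)}
  univ_sets := by simp
  sets_of_superset := by
    intro S T hS hST
    exact tendsto_of_tendsto_of_tendsto_of_le_of_le tendsto_const_nhds hS (fun _ => zero_le)
      fun n => measure_mono fun ω h h' => h (hST h')
  inter_sets := by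
    intro S T hS hT
    have h := hS.add hT
    rw [add_zero] at h
    refine tendsto_of_tendsto_of_tendsto_of_le_of_le tendsto_const_nhds h (fun _ => zero_le)
      fun n => (measure_mono ?_).trans (measure_union_le _ _)
    intro ω hω
    by_contra hc
    simp only [mem_union, mem_ofPred_eq, not_or, not_not] at hc
    exact hω hc

theorem eventually_probFilter {P : Measure Ω} {p : ℕ × Ω → Prop} :
    (∀ᶠ x in probFilter P, p x) ↔ Tendsto (fun n => P {ω | ¬ p (n, ω)}) atTop (𝓝 0) :=
  Iff.rfl

theorem tendsto_fst_probFilter (P : Measure Ω) : Tendsto Prod.fst (probFilter P) atTop := by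
  intro S hS
  refine Tendsto.congr' ?_ tendsto_const_nhds
  filter_upwards [hS] with n hn
  have : {ω : Ω | (n, ω) ∉ Prod.fst ⁻¹' S} = ∅ := by
    ext ω; simpa using hn
  rw [this, measure_empty]

/-- Convergence in probability to a constant implies convergence in distribution, for random
elements of an arbitrary topological space. -/
theorem tendstoInDistribution_const_of_tendsto_probFilter {E : Type*} [TopologicalSpace E]
    [MeasurableSpace E] [OpensMeasurableSpace E] (P : Measure Ω) [IsProbabilityMeasure P]
    (X : ℕ → Ω → E) (hX : ∀ n, AEMeasurable (X n) P) (c : E)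
    (h : Tendsto (fun x : ℕ × Ω => X x.1 x.2) (probFilter P) (𝓝 c)) :
    TendstoInDistribution X atTop (fun _ : Ω => c) (fun _ => P) P := by
  refine ⟨hX, aemeasurable_const, ?_⟩
  refine ProbabilityMeasure.tendsto_iff_forall_integral_tendsto.2 ?_
  intro f
  simp only [ProbabilityMeasure.coe_mk]
  have hint : ∀ n, Integrable (fun ω => f (X n ω)) P := fun n =>
    Integrable.of_bound (f.continuous.measurable.comp_aemeasurable (hX n)).aestronglyMeasurable
      ‖f‖ (ae_of_all _ fun ω => f.norm_coe_le_norm _)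
  have hmap : ∀ n, ∫ x, f x ∂(P.map (X n)) = ∫ ω, f (X n ω) ∂P := fun n =>
    integral_map (hX n) f.continuous.measurable.aestronglyMeasurable
  have hc : ∫ x, f x ∂(P.map fun _ : Ω => c) = f c := by
    rw [integral_map aemeasurable_const f.continuous.measurable.aestronglyMeasurable]
    simp
  simp only [hmap, hc]
  rw [Metric.tendsto_atTop]
  intro ε hε
  have hfX := (f.continuous.tendsto c).comp h
  have hev := hfX.eventually (Metric.ball_mem_nhds (f c) (half_pos hε))
  rw [eventually_probFilter] at hev
  -- The added `1` keeps the divisor positive when `f = 0`.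
  have hB : (0 : ℝ) < 2 * ‖f‖ + 1 := by positivity
  have hev2 := (tendsto_order.1 hev).2 (ENNReal.ofReal (ε / 2 / (2 * ‖f‖ + 1)))
    (ENNReal.ofReal_pos.2 (by positivity))
  obtain ⟨N, hN⟩ := eventually_atTop.1 hev2
  refine ⟨N, fun n hn => ?_⟩
  specialize hN n hn
  set S : Set Ω := {ω | ε / 2 ≤ dist (f (X n ω)) (f c)} with hS
  have hSsub : P S ≤ ENNReal.ofReal (ε / 2 / (2 * ‖f‖ + 1)) := by
    refine le_trans (measure_mono ?_) hN.le
    intro ω hω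
    simpa [hS, Metric.mem_ball] using hω
  have hSm : NullMeasurableSet S P :=
    nullMeasurableSet_le aemeasurable_const
      ((f.continuous.measurable.comp_aemeasurable (hX n)).dist aemeasurable_const)
  have hSr : P.real S ≤ ε / 2 / (2 * ‖f‖ + 1) := ENNReal.toReal_le_of_le_ofReal (by positivity) hSsub
  have hle : ∀ ω, dist (f (X n ω)) (f c) ≤ ε / 2 + S.indicator (fun _ => 2 * ‖f‖) ω := by
    intro ω
    by_cases hω : ω ∈ S
    · rw [indicator_of_mem hω]
      have := f.dist_le_two_norm (X n ω) c
      linarith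
    · rw [indicator_of_notMem hω]
      have : dist (f (X n ω)) (f c) < ε / 2 := not_le.1 hω
      linarith
  have hSint : Integrable (S.indicator fun _ => 2 * ‖f‖) P :=
    (integrable_const _).indicator₀ hSm
  calc dist (∫ ω, f (X n ω) ∂P) (f c)
      = ‖∫ ω, (f (X n ω) - f c) ∂P‖ := by
        rw [integral_sub (hint n) (integrable_const _), integral_const, dist_eq_norm]; simp
    _ ≤ ∫ ω, ‖f (X n ω) - f c‖ ∂P := norm_integral_le_integral_norm _
    _ ≤ ∫ ω, (ε / 2 + S.indicator (fun _ => 2 * ‖f‖) ω) ∂P := by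
        refine integral_mono ((hint n).sub (integrable_const _)).norm
          ((integrable_const _).add hSint) fun ω => ?_
        simpa [dist_eq_norm] using hle ω
    _ = ε / 2 + P.real S * (2 * ‖f‖) := by
        rw [integral_add (integrable_const _) hSint, integral_indicator₀ hSm]; simp
    _ < ε := by
        have h1 : P.real S * (2 * ‖f‖ + 1) ≤ ε / 2 := (le_div_iff₀ hB).1 hSr
        have h2 : 0 ≤ P.real S := measureReal_nonneg
        rcases h2.eq_or_lt with h3 | h3
        · rw [← h3]; linarith
        · nlinarith

/-- A weak law of large numbers for row sums of a triangular array obtained by applying bounded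
functions to an iid sequence, with arbitrary norming constants tending to infinity. -/
theorem tendsto_probFilter_sum_div {E : Type*} [MeasurableSpace E] (P : Measure Ω)
    [IsProbabilityMeasure P] (Q : Measure E) [IsProbabilityMeasure Q] (Z : ℕ → Ω → E)
    (hlaw : ∀ i, HasLaw (Z i) Q P) (hindep : iIndepFun Z P) (g : ℕ → E → ℝ)
    (hg : ∀ n, Measurable (g n)) (M : ℝ) (hg0 : ∀ n z, 0 ≤ g n z) (hgM : ∀ n z, g n z ≤ M)
    (c : ℕ → ℝ) (hc : Tendsto c atTop atTop) (m : ℝ)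
    (hm : Tendsto (fun n : ℕ => n / c n * ∫ z, g n z ∂Q) atTop (𝓝 m)) :
    Tendsto (fun x : ℕ × Ω => (∑ i : Fin x.1, g x.1 (Z i x.2)) / c x.1) (probFilter P) (𝓝 m) := by
  have hmem : ∀ n i, MemLp (fun ω => g n (Z i ω)) 2 P := fun n i =>
    MemLp.of_bound ((hg n).comp_aemeasurable (hlaw i).aemeasurable).aestronglyMeasurable M
      (ae_of_all _ fun z => by rw [Real.norm_of_nonneg (hg0 n _)]; exact hgM n _)
  have hE : ∀ n i, ∫ ω, g n (Z i ω) ∂P = ∫ z, g n z ∂Q := fun n i => by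
    rw [← (hlaw i).map_eq, integral_map (hlaw i).aemeasurable (hg n).aestronglyMeasurable]
  set S : ℕ → Ω → ℝ := fun n => ∑ i : Fin n, fun ω => g n (Z i ω) with hSdef
  have hSapp : ∀ n ω, S n ω = ∑ i : Fin n, g n (Z i ω) := fun n ω => by simp [hSdef]
  have hSmem : ∀ n, MemLp (S n) 2 P := fun n => memLp_finsetSum' _ fun i _ => hmem n i
  have hSE : ∀ n, ∫ ω, S n ω ∂P = n * ∫ z, g n z ∂Q := fun n => by
    simp only [hSapp]
    rw [integral_finsetSum _ fun (i : Fin n) _ => (hmem n i).integrable (by norm_num)]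
    simp [hE]
  -- Since `0 ≤ g ≤ M`, each variance is at most `E g² ≤ M E g`: it is controlled by the mean, which
  -- is of order `c n / n`.
  have hSV : ∀ n, variance (S n) P ≤ n * (M * ∫ z, g n z ∂Q) := fun n => by
    rw [hSdef]
    simp only
    rw [IndepFun.variance_sum (fun (i : Fin n) _ => hmem n i)]
    · refine (Finset.sum_le_card_nsmul _ _ (M * ∫ z, g n z ∂Q) fun i _ => ?_).trans (by simp)
      refine (variance_le_expectation_sq (hmem n i).aestronglyMeasurable).trans ?_
      rw [← hE n i, ← integral_const_mul]
      refine integral_mono (hmem n i).integrable_sq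
        (((hmem n i).integrable (by norm_num)).const_mul M) fun ω => ?_
      simp only [Pi.pow_apply, sq]
      exact mul_le_mul_of_nonneg_right (hgM n _) (hg0 n _)
    · intro i _ j _ hij
      exact (hindep.indepFun (fun h => hij (Fin.ext h))).comp (hg n) (hg n)
  rw [Metric.tendsto_nhds]
  intro ε hε
  rw [eventually_probFilter]
  -- This is Chebyshev's bound: a convergent factor times `1 / c n`. Half of `ε` is spent on the
  -- fluctuation, half on the bias of the mean.
  have hbound : Tendsto (fun n : ℕ => ENNReal.ofReal
      (M * (n / c n * ∫ z, g n z ∂Q) / (ε / 2) ^ 2 * (c n)⁻¹)) atTop (𝓝 0) := by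
    rw [← ENNReal.ofReal_zero]
    refine ENNReal.tendsto_ofReal ?_
    have := ((hm.const_mul M).div_const ((ε / 2) ^ 2)).mul (tendsto_inv_atTop_zero.comp hc)
    simpa using this
  refine tendsto_of_tendsto_of_tendsto_of_le_of_le' tendsto_const_nhds hbound
    (Eventually.of_forall fun _ => zero_le) ?_
  filter_upwards [hc.eventually_gt_atTop 0, Metric.tendsto_nhds.1 hm _ (half_pos hε)] with n hcn hmn
  have hcheb := meas_ge_le_variance_div_sq (hSmem n) (c := c n * (ε / 2)) (by positivity)
  refine (measure_mono ?_).trans (hcheb.trans (ENNReal.ofReal_le_ofReal ?_))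
  · intro ω hω
    simp only [mem_ofPred_eq, not_lt] at hω ⊢
    rw [← hSapp, Real.dist_eq] at hω
    rw [hSE]
    rw [Real.dist_eq] at hmn
    have h1 : ε / 2 ≤ |S n ω / c n - n / c n * ∫ z, g n z ∂Q| := by
      have := abs_sub_le (S n ω / c n) (n / c n * ∫ z, g n z ∂Q) m
      linarith
    have h2 : S n ω / c n - n / c n * ∫ z, g n z ∂Q = (S n ω - n * ∫ z, g n z ∂Q) / c n := by
      ring
    rw [h2, abs_div, abs_of_pos hcn, le_div_iff₀ hcn] at h1
    linarith
  · have h3 : M * (n / c n * ∫ z, g n z ∂Q) / (ε / 2) ^ 2 * (c n)⁻¹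
        = n * (M * ∫ z, g n z ∂Q) / (c n * (ε / 2)) ^ 2 := by
      field_simp
    rw [h3]
    gcongr
    exact hSV n

end ConvergenceInProbability

/-! ### Order statistics: threshold counts and continuity. -/

section KthLargest

variable {ι : Type*} [Fintype ι]

/-- If fewer than `k` values reach `t`, every admissible threshold is reached by some value below
`t`, so the supremum is at most the largest such value. At `t = 0` the equivalence fails once `k`
exceeds the number of values. -/
theorem le_kthLargest_iff {k : ℕ} {x : ι → ℝ≥0∞} {t : ℝ≥0∞} (ht : 0 < t) :
    t ≤ kthLargest k x ↔ k ≤ (Finset.univ.filter fun i => t ≤ x i).card := by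
  refine ⟨fun h => ?_, fun h => le_sSup h⟩
  by_contra! hlt
  set m := (Finset.univ.filter fun i => x i < t).sup x with hm
  have hmt : m < t := by
    rw [hm, Finset.sup_lt_iff ht]
    intro i hi
    simpa using hi
  refine absurd h (not_le.2 (lt_of_le_of_lt (sSup_le fun s hs => ?_) hmt))
  have hs' : k ≤ (Finset.univ.filter fun i => s ≤ x i).card := hs
  have hns : ¬ (Finset.univ.filter fun i => s ≤ x i) ⊆ (Finset.univ.filter fun i => t ≤ x i) :=
    fun hsub => by have := Finset.card_le_card hsub; omega
  obtain ⟨i, hi, hi'⟩ := Finset.not_subset.1 hns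
  simp only [Finset.mem_filter, Finset.mem_univ, true_and, not_le] at hi hi'
  exact hi.trans (Finset.le_sup (f := x) (by simpa using hi'))

theorem lt_kthLargest_iff {k : ℕ} (hk : 1 ≤ k) {x : ι → ℝ≥0∞} {t : ℝ≥0∞} :
    t < kthLargest k x ↔ k ≤ (Finset.univ.filter fun i => t < x i).card := by
  constructor
  · intro h
    obtain ⟨s, hs, hts⟩ := lt_sSup_iff.1 h
    refine le_trans hs (Finset.card_le_card fun j hj => ?_)
    simp only [Finset.mem_filter, Finset.mem_univ, true_and] at hj ⊢
    exact hts.trans_le hj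
  · intro h
    set s := Finset.univ.filter fun j => t < x j with hs
    refine lt_sSup_iff.2 ⟨s.inf x, ?_, ?_⟩
    · refine le_trans h (Finset.card_le_card fun j hj => ?_)
      simpa using Finset.inf_le hj
    · obtain ⟨j, hj⟩ : s.Nonempty := Finset.card_pos.1 (by omega)
      have hjt : t < x j := by simpa [hs] using hj
      rw [Finset.lt_inf_iff (hjt.trans_le le_top)]
      intro i hi
      simpa [hs] using hi

theorem kthLargest_const_mul (k : ℕ) (x : ι → ℝ≥0∞) {c : ℝ≥0∞} (hc0 : c ≠ 0) (hc : c ≠ ∞) :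
    (kthLargest k fun i => c * x i) = c * kthLargest k x := by
  refine eq_of_forall_le_iff fun t => ?_
  rcases eq_or_ne t 0 with rfl | ht
  · simp
  have hiff : ∀ y, t ≤ c * y ↔ t / c ≤ y := fun y => by
    rw [ENNReal.div_le_iff hc0 hc, mul_comm]
  rw [le_kthLargest_iff ht.bot_lt, hiff, le_kthLargest_iff (ENNReal.div_pos ht hc)]
  simp only [hiff]

/-- Upper level sets, strict or weak, are finite unions of finite intersections of coordinate
half-spaces, indexed by the sets of at least `k` indices. -/
theorem continuous_kthLargest {k : ℕ} (hk : 1 ≤ k) :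
    Continuous (kthLargest k : (ι → ℝ≥0∞) → ℝ≥0∞) := by
  classical
  rw [OrderTopology.continuous_iff]
  intro a
  constructor
  · have : kthLargest k ⁻¹' Ioi a
        = ⋃ s ∈ {s : Finset ι | k ≤ s.card}, ⋂ j ∈ s, {x : ι → ℝ≥0∞ | a < x j} := by
      ext x
      simp only [mem_preimage, mem_Ioi, lt_kthLargest_iff hk, mem_iUnion, mem_iInter,
        mem_ofPred_eq, exists_prop]
      exact ⟨fun h => ⟨_, h, fun j hj => by simpa using hj⟩, fun ⟨s, hs, hx⟩ =>
        hs.trans (Finset.card_le_card fun j hj => by simpa using hx j hj)⟩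
    rw [this]
    exact isOpen_biUnion fun s _ =>
      isOpen_biInter_finset fun j _ => isOpen_lt continuous_const (continuous_apply j)
  · rcases eq_or_ne a 0 with rfl | ha
    · convert isOpen_empty
      ext x
      simp
    rw [← isClosed_compl_iff]
    have : (kthLargest k ⁻¹' Iio a)ᶜ
        = ⋃ s ∈ {s : Finset ι | k ≤ s.card}, ⋂ j ∈ s, {x : ι → ℝ≥0∞ | a ≤ x j} := by
      ext x
      simp only [mem_compl_iff, mem_preimage, mem_Iio, not_lt, le_kthLargest_iff ha.bot_lt,
        mem_iUnion, mem_iInter, mem_ofPred_eq, exists_prop]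
      exact ⟨fun h => ⟨_, h, fun j hj => by simpa using hj⟩, fun ⟨s, hs, hx⟩ =>
        hs.trans (Finset.card_le_card fun j hj => by simpa using hx j hj)⟩
    rw [this]
    exact (toFinite _).isClosed_biUnion fun s _ =>
      isClosed_biInter fun j _ => isClosed_le continuous_const (continuous_apply j)

end KthLargest

/-! ### Test functions on a cone, extended by zero to the compact space. -/

section TestFunctions

variable {d l : ℕ}

theorem measurableSet_cone (d l : ℕ) : MeasurableSet (cone d l) := (isOpen_cone d l).measurableSet

/-- The extension by zero to `[0, ∞]^d` of a test function on a cone. -/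
noncomputable def extendZero (f : CompactlySupportedContinuousMap (cone d l) ℝ≥0) : (Fin d → ℝ≥0∞) → ℝ≥0 :=
  Function.extend Subtype.val f 0

theorem extendZero_coe (f : CompactlySupportedContinuousMap (cone d l) ℝ≥0) (x : cone d l) :
    extendZero f x = f x :=
  Subtype.val_injective.extend_apply f 0 x

theorem extendZero_of_notMem (f : CompactlySupportedContinuousMap (cone d l) ℝ≥0)
    {x : Fin d → ℝ≥0∞} (hx : x ∉ cone d l) : extendZero f x = 0 := by
  rw [extendZero, Function.extend_apply']
  · rfl
  · rintro ⟨y, rfl⟩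
    exact hx y.2

theorem continuous_extendZero (f : CompactlySupportedContinuousMap (cone d l) ℝ≥0) :
    Continuous (extendZero f) :=
  HasCompactSupport.continuous_extend_zero (isOpen_cone d l) f.continuous f.hasCompactSupport

/-- The `l`-th largest component is continuous and positive on the cone, so it has a positive
minimum on a nonempty compact support. -/
theorem exists_le_kthLargest_of_extendZero_ne_zero (hl : 1 ≤ l)
    (f : CompactlySupportedContinuousMap (cone d l) ℝ≥0) :
    ∃ δ : ℝ≥0∞, 0 < δ ∧ δ ≠ ∞ ∧ ∀ x, extendZero f x ≠ 0 → δ ≤ kthLargest l x := by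
  have hmem : ∀ x, extendZero f x ≠ 0 → ∃ y : cone d l, y.1 = x ∧ y ∈ tsupport f := fun x hx => by
    have hxc : x ∈ cone d l := by
      by_contra h
      exact hx (extendZero_of_notMem f h)
    refine ⟨⟨x, hxc⟩, rfl, subset_tsupport f ?_⟩
    rw [Function.mem_support, ← extendZero_coe]
    exact hx
  rcases (tsupport f).eq_empty_or_nonempty with h | h
  · refine ⟨1, one_pos, ENNReal.one_ne_top, fun x hx => ?_⟩
    obtain ⟨y, -, hy⟩ := hmem x hx
    simp [h] at hy
  · obtain ⟨m, -, hmin⟩ := f.hasCompactSupport.isCompact.exists_isMinOn h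
      ((continuous_kthLargest hl).comp continuous_subtype_val).continuousOn
    refine ⟨min 1 (kthLargest l m.1), lt_min one_pos m.2, by simp, fun x hx => ?_⟩
    obtain ⟨y, rfl, hy⟩ := hmem x hx
    exact (min_le_right _ _).trans (hmin hy)

theorem exists_extendZero_le (f : CompactlySupportedContinuousMap (cone d l) ℝ≥0) :
    ∃ M : ℝ≥0, ∀ x, extendZero f x ≤ M := by
  obtain ⟨M, hM⟩ := (isCompact_range (continuous_extendZero f)).bddAbove
  exact ⟨M, fun x => hM (mem_range_self x)⟩

theorem lintegral_traceOn (f : CompactlySupportedContinuousMap (cone d l) ℝ≥0)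
    (μ : Measure (Fin d → ℝ≥0∞)) [IsFiniteMeasure μ] :
    ∫⁻ x, f x ∂(traceOn (cone d l) μ).1 = ∫⁻ x, extendZero f x ∂μ := by
  simp only [← extendZero_coe f]
  change ∫⁻ x : cone d l, (extendZero f x : ℝ≥0∞) ∂(μ.comap Subtype.val) = _
  rw [lintegral_subtype_comap (measurableSet_cone d l) fun x => (extendZero f x : ℝ≥0∞)]
  refine setLIntegral_eq_of_support_subset fun x hx => ?_
  by_contra h
  exact hx (by simp [extendZero_of_notMem f h])

theorem RadonMeasure.lintegral_ne_top {E : Type*} [TopologicalSpace E] [MeasurableSpace E]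
    [OpensMeasurableSpace E] (μ : RadonMeasure E) (f : CompactlySupportedContinuousMap E ℝ≥0) :
    ∫⁻ x, f x ∂μ.1 ≠ ∞ := by
  have := μ.2
  have h := (Continuous.integrable_of_hasCompactSupport (μ := μ.1)
    (NNReal.continuous_coe.comp f.continuous)
    (f.hasCompactSupport.comp_left NNReal.coe_zero)).hasFiniteIntegral
  simpa [HasFiniteIntegral] using h.ne

end TestFunctions

/-! ### Vague convergence and portmanteau inequalities. -/

section Portmanteau

/-- The filter is arbitrary, so vague convergence in probability can also be checked one test
function at a time, without metrizing the space of measures. -/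
theorem tendsto_radonMeasure_iff {E α : Type*} [TopologicalSpace E] [MeasurableSpace E]
    {L : Filter α} {μ : α → RadonMeasure E} {μ₀ : RadonMeasure E} :
    Tendsto μ L (𝓝 μ₀) ↔ ∀ f : CompactlySupportedContinuousMap E ℝ≥0,
      Tendsto (fun x => ∫⁻ y, f y ∂(μ x).1) L (𝓝 (∫⁻ y, f y ∂μ₀.1)) := by
  have : IsInducing (fun (μ : RadonMeasure E) (f : CompactlySupportedContinuousMap E ℝ≥0) =>
      ∫⁻ x, (f x : ℝ≥0∞) ∂μ.1) := ⟨rfl⟩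
  rw [this.tendsto_nhds_iff, tendsto_pi_nhds]
  rfl

theorem traceOn_apply {X : Type*} [TopologicalSpace X] [MeasurableSpace X] [BorelSpace X]
    {C : Set X} (hC : IsOpen C) (m : Measure X) [IsFiniteMeasure m] (A : Set C) :
    (traceOn C m).1 A = m (Subtype.val '' A) :=
  (MeasurableEmbedding.subtype_coe hC.measurableSet).comap_apply m A

variable {X α : Type*} [TopologicalSpace X] [CompactSpace X] [T2Space X] [MeasurableSpace X]
  [BorelSpace X] {C F O : Set X} {L : Filter α} {μ : α → Measure X} [∀ x, IsFiniteMeasure (μ x)]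
  {ν : RadonMeasure C} {c : ℝ≥0∞}

/-- A closed subset of the compact ambient space that lies in `C` is compact in `C`, so Urysohn's
lemma applies. Working with pairs `F ⊆ O` avoids any condition on the mass of boundaries. -/
theorem exists_compactlySupported_between (hC : IsOpen C) (hF : IsClosed F) (hO : IsOpen O)
    (hFO : F ⊆ O) (hFC : F ⊆ C) :
    ∃ g : CompactlySupportedContinuousMap C ℝ≥0,
      ∀ m : Measure C, m (Subtype.val ⁻¹' F) ≤ ∫⁻ x, g x ∂m ∧
        ∫⁻ x, g x ∂m ≤ m (Subtype.val ⁻¹' O) := by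
  have : LocallyCompactSpace C := hC.locallyCompactSpace
  have hFm : MeasurableSet (Subtype.val ⁻¹' F : Set C) :=
    (hF.preimage continuous_subtype_val).measurableSet
  have hOm : MeasurableSet (Subtype.val ⁻¹' O : Set C) :=
    (hO.preimage continuous_subtype_val).measurableSet
  have hFc : IsCompact (Subtype.val ⁻¹' F : Set C) := by
    rw [Subtype.isCompact_iff, Subtype.image_preimage_coe, inter_eq_right.2 hFC]
    exact hF.isCompact
  obtain ⟨f, hf1, hf0, hfc, hf⟩ := exists_continuous_one_zero_of_isCompact hFc
    (hO.preimage continuous_subtype_val).isClosed_compl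
    (disjoint_left.2 fun x hx hx' => hx' (hFO hx))
  refine ⟨⟨⟨fun x => (f x).toNNReal, continuous_real_toNNReal.comp f.continuous⟩,
    hfc.comp_left Real.toNNReal_zero⟩, fun m => ⟨?_, ?_⟩⟩
  · rw [← lintegral_indicator_one hFm]
    refine lintegral_mono fun x => ?_
    by_cases hx : x ∈ (Subtype.val ⁻¹' F : Set C)
    · simp [indicator_of_mem hx, hf1 hx]
    · simp [indicator_of_notMem hx]
  · rw [← lintegral_indicator_one hOm]
    refine lintegral_mono fun x => ?_
    by_cases hx : x ∈ (Subtype.val ⁻¹' O : Set C)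
    · simpa [indicator_of_mem hx] using (hf x).2
    · simp [indicator_of_notMem hx, hf0 hx]

theorem eventually_measure_lt_of_tendsto_traceOn (hC : IsOpen C)
    (h : Tendsto (fun x => traceOn C (μ x)) L (𝓝 ν)) (hF : IsClosed F) (hO : IsOpen O)
    (hFO : F ⊆ O) (hFC : F ⊆ C) (hc : ν.1 (Subtype.val ⁻¹' O) < c) : ∀ᶠ x in L, μ x F < c := by
  obtain ⟨g, hg⟩ := exists_compactlySupported_between hC hF hO hFO hFC
  filter_upwards [(tendsto_radonMeasure_iff.1 h g).eventually_lt_const ((hg ν.1).2.trans_lt hc)]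
    with x hx
  have := (hg (traceOn C (μ x)).1).1.trans_lt hx
  rwa [traceOn_apply hC, Subtype.image_preimage_coe, inter_eq_right.2 hFC] at this

theorem eventually_lt_measure_of_tendsto_traceOn (hC : IsOpen C)
    (h : Tendsto (fun x => traceOn C (μ x)) L (𝓝 ν)) (hF : IsClosed F) (hO : IsOpen O)
    (hFO : F ⊆ O) (hFC : F ⊆ C) (hc : c < ν.1 (Subtype.val ⁻¹' F)) : ∀ᶠ x in L, c < μ x O := by
  obtain ⟨g, hg⟩ := exists_compactlySupported_between hC hF hO hFO hFC
  filter_upwards [(tendsto_radonMeasure_iff.1 h g).eventually_const_lt (hc.trans_le (hg ν.1).1)]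
    with x hx
  refine (hx.trans_le (hg _).2).trans_le ?_
  rw [traceOn_apply hC, Subtype.image_preimage_coe]
  exact measure_mono inter_subset_right

end Portmanteau

/-! ### The left-continuous inverse. -/

section LeftInverse

theorem leftInverse_bddBelow (a : ℝ → ℝ) (x : ℝ) : BddBelow {s | 0 < s ∧ x ≤ a s} :=
  ⟨0, fun _ hs => hs.1.le⟩

/-- Together with `le_leftInverse` this brackets the event `a s < x` between `s < a←(x)` and `s ≤
a←(x)`; no continuity of `a` is available to make them equal. -/
theorem lt_of_lt_leftInverse {a : ℝ → ℝ} {s x : ℝ} (hs : 0 < s) (h : s < leftInverse a x) :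
    a s < x := by
  by_contra! hle
  exact absurd (csInf_le (leftInverse_bddBelow a x) ⟨hs, hle⟩) (not_le.2 h)

/-- Rules out the default value `0` of the infimum of an empty set. -/
theorem leftInverse_nonempty {a : ℝ → ℝ} (ha : Tendsto a atTop atTop) (x : ℝ) :
    {s | 0 < s ∧ x ≤ a s}.Nonempty :=
  ((eventually_gt_atTop 0).and (ha.eventually_ge_atTop x)).exists

theorem le_leftInverse {a : ℝ → ℝ} (ha : Tendsto a atTop atTop) (hmono : MonotoneOn a (Ioi 0))
    {s x : ℝ} (hs : 0 < s) (h : a s < x) : s ≤ leftInverse a x := by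
  refine le_csInf (leftInverse_nonempty ha x) fun r hr => ?_
  by_contra! hlt
  exact absurd (hr.2.trans (hmono hr.1 hs hlt.le)) (not_le.2 h)

theorem monotone_leftInverse {a : ℝ → ℝ} (ha : Tendsto a atTop atTop) :
    Monotone (leftInverse a) := fun x y hxy =>
  csInf_le_csInf (leftInverse_bddBelow a x) (leftInverse_nonempty ha y)
    fun _ hs => ⟨hs.1, hxy.trans hs.2⟩

theorem measurable_standardize {d : ℕ} {a : Fin d → ℝ → ℝ}
    (ha : ∀ j, Tendsto (a j) atTop atTop) : Measurable (standardize a) :=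
  measurable_pi_lambda _ fun j => (monotone_leftInverse (ha j)).measurable.comp
    (NNReal.continuous_coe.measurable.comp (measurable_pi_apply j))

end LeftInverse

/-! ### Tails of the standardized components. -/

section MarginalTails

variable {d : ℕ} {Q : Measure (Fin d → ℝ≥0)} [IsProbabilityMeasure Q] {a : Fin d → ℝ → ℝ}

theorem paretoMeasure_Ioi {β : ℝ} (hβ : 0 < β) {x : ℝ} (hx : 0 < x) :
    (paretoMeasure β hβ).1 (Subtype.val ⁻¹' Ioi (ENNReal.ofReal x)) = ENNReal.ofReal (x ^ (-β)) := by
  change (paretoBase β).comap Subtype.val _ = _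
  rw [(MeasurableEmbedding.subtype_coe measurableSet_Ioi).comap_apply, Subtype.image_preimage_coe,
    inter_eq_right.2 (Ioi_subset_Ioi zero_le), paretoBase_Ioi hβ hx]

/-- The limit tail `x^(-β)` is continuous and equals `1` at level one whatever `β` is, so the
exponent plays no further role. -/
theorem tendsto_mul_measure_scaling_lt {j : Fin d} (ha : Tendsto (a j) atTop atTop) {β : ℝ}
    (hβ : 0 < β) (h : Tendsto (fun t : ℝ => traceOn (Ioi (0 : ℝ≥0∞))
      (t.toNNReal • Q.map fun z => ENNReal.ofReal (z j / a j t))) atTop (𝓝 (paretoMeasure β hβ))) :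
    Tendsto (fun t => t * Q.real {z | a j t < z j}) atTop (𝓝 1) := by
  have hcont : Tendsto (fun x : ℝ => x ^ (-β)) (𝓝 1) (𝓝 1) := by
    have := Real.continuousAt_rpow_const 1 (-β) (Or.inl one_ne_zero)
    simpa [ContinuousAt] using this
  have hmeas : ∀ t, Measurable fun z : Fin d → ℝ≥0 => ENNReal.ofReal (z j / a j t) := fun t => by
    fun_prop
  have happ : ∀ (t : ℝ) (S : Set ℝ≥0∞), MeasurableSet S →
      (t.toNNReal • Q.map fun z => ENNReal.ofReal (z j / a j t)) S
        = ENNReal.ofReal t * Q {z | ENNReal.ofReal (z j / a j t) ∈ S} := fun t S hS => by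
    rw [Measure.smul_apply, Measure.map_apply (hmeas t) hS]; rfl
  rw [tendsto_order]
  constructor
  · intro c hc
    obtain ⟨q, hq, hq1⟩ : ∃ q : ℝ, c < q ^ (-β) ∧ 1 < q :=
      (((hcont.eventually_const_lt hc).filter_mono nhdsWithin_le_nhds).and
        (self_mem_nhdsWithin (s := Ioi (1 : ℝ)))).exists
    have hq0 : 0 < q := one_pos.trans hq1
    have hF : (paretoMeasure β hβ).1 (Subtype.val ⁻¹' Ioi (ENNReal.ofReal q))
        ≤ (paretoMeasure β hβ).1 (Subtype.val ⁻¹' Ici (ENNReal.ofReal q)) :=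
      measure_mono (preimage_mono Ioi_subset_Ici_self)
    rw [paretoMeasure_Ioi hβ hq0] at hF
    have hlt : ENNReal.ofReal c < ENNReal.ofReal (q ^ (-β)) :=
      (ENNReal.ofReal_lt_ofReal_iff (Real.rpow_pos_of_pos hq0 _)).2 hq
    filter_upwards [eventually_lt_measure_of_tendsto_traceOn isOpen_Ioi h isClosed_Ici isOpen_Ioi
      (O := Ioi 1) (Ici_subset_Ioi.2 (by simpa using hq1))
      (Ici_subset_Ioi.2 (by simpa using hq0)) (hlt.trans_le hF), eventually_gt_atTop 0,
      ha.eventually_gt_atTop 0] with t ht ht0 hat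
    rw [happ t _ measurableSet_Ioi, ← ofReal_measureReal, ← ENNReal.ofReal_mul ht0.le] at ht
    have hset : {z : Fin d → ℝ≥0 | ENNReal.ofReal (z j / a j t) ∈ Ioi 1} = {z | a j t < z j} := by
      ext z
      simp [one_lt_div hat]
    rw [hset] at ht
    exact (ENNReal.ofReal_lt_ofReal_iff'.1 ht).1
  · intro c hc
    obtain ⟨p, ⟨hp, hp0⟩, hp1⟩ : ∃ p : ℝ, (p ^ (-β) < c ∧ 0 < p) ∧ p < 1 :=
      ((((hcont.eventually_lt_const hc).and (lt_mem_nhds one_pos)).filter_mono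
        nhdsWithin_le_nhds).and (self_mem_nhdsWithin (s := Iio (1 : ℝ)))).exists
    filter_upwards [eventually_measure_lt_of_tendsto_traceOn isOpen_Ioi h (F := Ici 1) isClosed_Ici
      isOpen_Ioi (O := Ioi (ENNReal.ofReal p)) (Ici_subset_Ioi.2 (by simpa using hp1))
      (Ici_subset_Ioi.2 one_pos) (c := ENNReal.ofReal c)
      (by rw [paretoMeasure_Ioi hβ hp0]
          exact (ENNReal.ofReal_lt_ofReal_iff (one_pos.trans hc)).2 hp), eventually_gt_atTop 0,
      ha.eventually_gt_atTop 0] with t ht ht0 hat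
    rw [happ t _ measurableSet_Ici, ← ofReal_measureReal, ← ENNReal.ofReal_mul ht0.le] at ht
    refine lt_of_le_of_lt ?_ (ENNReal.ofReal_lt_ofReal_iff'.1 ht).1
    refine mul_le_mul_of_nonneg_left (measureReal_mono fun z hz => ?_) ht0.le
    simp only [mem_ofPred_eq, mem_Ici, ENNReal.one_le_ofReal] at hz ⊢
    exact (one_le_div hat).2 hz.le

/-- Both versions of the upper tail of a standardized component are asymptotic to `1 / x`. -/
theorem tendsto_mul_measure_standardize {j : Fin d} (ha : Tendsto (a j) atTop atTop)
    (hmono : MonotoneOn (a j) (Ioi 0))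
    (h : Tendsto (fun t => t * Q.real {z | a j t < z j}) atTop (𝓝 1)) {y : ℝ} (hy : 0 < y) :
    Tendsto (fun t => t * Q.real {z | t * y < standardize a z j}) atTop (𝓝 y⁻¹) ∧
    Tendsto (fun t => t * Q.real {z | t * y ≤ standardize a z j}) atTop (𝓝 y⁻¹) := by
  have hscale : ∀ x : ℝ, 0 < x →
      Tendsto (fun t => t * Q.real {z | a j (t * x) < z j}) atTop (𝓝 x⁻¹) := fun x hx => by
    have := (h.comp (tendsto_id.atTop_mul_const hx)).const_mul x⁻¹
    rw [mul_one] at this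
    refine this.congr fun t => ?_
    simp only [Function.comp, id]
    field_simp
  have hle : ∀ t, 0 < t → t * Q.real {z | t * y < standardize a z j}
      ≤ t * Q.real {z | t * y ≤ standardize a z j} := fun t ht =>
    mul_le_mul_of_nonneg_left (measureReal_mono fun z hz => by
      simp only [mem_ofPred_eq] at hz ⊢
      exact hz.le) ht.le
  have hinv : Tendsto (fun x : ℝ => x⁻¹) (𝓝 y) (𝓝 y⁻¹) := tendsto_inv₀ hy.ne'
  -- Moving the level slightly, up to `q` here and down to `p` below, absorbs the gap between strict
  -- and weak inequalities for the inverse.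
  have hlow : ∀ c < y⁻¹, ∀ᶠ t in atTop, c < t * Q.real {z | t * y < standardize a z j} := by
    intro c hc
    obtain ⟨q, hq, hqy⟩ : ∃ q : ℝ, c < q⁻¹ ∧ y < q :=
      (((hinv.eventually_const_lt hc).filter_mono nhdsWithin_le_nhds).and
        (self_mem_nhdsWithin (s := Ioi y))).exists
    have hq0 := hy.trans hqy
    filter_upwards [(hscale q hq0).eventually_const_lt hq, eventually_gt_atTop 0] with t ht ht0
    refine ht.trans_le (mul_le_mul_of_nonneg_left (measureReal_mono fun z hz => ?_) ht0.le)
    exact (mul_lt_mul_of_pos_left hqy ht0).trans_le (le_leftInverse ha hmono (by positivity) hz)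
  have hupp : ∀ c > y⁻¹, ∀ᶠ t in atTop, t * Q.real {z | t * y ≤ standardize a z j} < c := by
    intro c hc
    obtain ⟨p, ⟨hp, hp0⟩, hpy⟩ : ∃ p : ℝ, (p⁻¹ < c ∧ 0 < p) ∧ p < y :=
      ((((hinv.eventually_lt_const hc).and (lt_mem_nhds hy)).filter_mono
        nhdsWithin_le_nhds).and (self_mem_nhdsWithin (s := Iio y))).exists
    filter_upwards [(hscale p hp0).eventually_lt_const hp, eventually_gt_atTop 0] with t ht ht0
    refine lt_of_le_of_lt (mul_le_mul_of_nonneg_left (measureReal_mono fun z hz => ?_) ht0.le) ht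
    exact lt_of_lt_leftInverse (by positivity) ((mul_lt_mul_of_pos_left hpy ht0).trans_le hz)
  simp only [tendsto_order]
  refine ⟨⟨hlow, fun c hc => ?_⟩, fun c hc => ?_, hupp⟩
  · filter_upwards [hupp c hc, eventually_gt_atTop 0] with t ht ht0 using (hle t ht0).trans_lt ht
  · filter_upwards [hlow c hc, eventually_gt_atTop 0] with t ht ht0 using ht.trans_le (hle t ht0)

end MarginalTails

/-! ### Growth of scaling functions and strict monotonicity of the limit mass. -/

section ScalingFunction

variable {d l : ℕ} {Q : Measure (Fin d → ℝ≥0)} {a : Fin d → ℝ → ℝ}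
  {b : ℝ → ℝ}

/-- The standardized vector divided by `r`, as a point of `[0, ∞]^d`. -/
noncomputable def scaledPoint (a : Fin d → ℝ → ℝ) (r : ℝ) (z : Fin d → ℝ≥0) : Fin d → ℝ≥0∞ :=
  fun j => ENNReal.ofReal (standardize a z j / r)

theorem measurable_scaledPoint (ha : ∀ j, Tendsto (a j) atTop atTop) (r : ℝ) :
    Measurable (scaledPoint a r) :=
  measurable_pi_lambda _ fun j => ENNReal.measurable_ofReal.comp
    (((measurable_pi_apply j).comp (measurable_standardize ha)).div_const r)

theorem map_map_standardize (ha : ∀ j, Tendsto (a j) atTop atTop) (r : ℝ) :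
    (Q.map (standardize a)).map (fun u (j : Fin d) => ENNReal.ofReal (u j / r))
      = Q.map (scaledPoint a r) := by
  rw [Measure.map_map (by fun_prop) (measurable_standardize ha)]
  rfl

variable [IsProbabilityMeasure Q]

theorem IsRegularlyVarying.tendsto_traceOn (ha : ∀ j, Tendsto (a j) atTop atTop)
    {ν : RadonMeasure (cone d l)} (h : IsRegularlyVarying l (Q.map (standardize a)) b ν) :
    Tendsto (fun t : ℝ => traceOn (cone d l) (t.toNNReal • Q.map (scaledPoint a (b t)))) atTop
      (𝓝 ν) := by
  have := h.vague
  simp only [map_map_standardize ha] at this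
  exact this

theorem smul_map_scaledPoint_apply (ha : ∀ j, Tendsto (a j) atTop atTop) {t : ℝ} (ht : 0 ≤ t)
    (r : ℝ) {S : Set (Fin d → ℝ≥0∞)} (hS : MeasurableSet S) :
    (t.toNNReal • Q.map (scaledPoint a r)) S
      = ENNReal.ofReal (t * Q.real {z | scaledPoint a r z ∈ S}) := by
  rw [Measure.smul_apply, Measure.map_apply (measurable_scaledPoint ha r) hS,
    ENNReal.ofReal_mul ht, ofReal_measureReal]
  rfl

theorem isClosed_le_kthLargest (hl : 1 ≤ l) (q : ℝ≥0∞) :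
    IsClosed {x : Fin d → ℝ≥0∞ | q ≤ kthLargest l x} :=
  isClosed_le continuous_const (continuous_kthLargest hl)

theorem isOpen_lt_kthLargest (hl : 1 ≤ l) (q : ℝ≥0∞) :
    IsOpen {x : Fin d → ℝ≥0∞ | q < kthLargest l x} :=
  isOpen_lt continuous_const (continuous_kthLargest hl)

theorem le_kthLargest_subset_cone {q : ℝ≥0∞} (hq : 0 < q) :
    {x : Fin d → ℝ≥0∞ | q ≤ kthLargest l x} ⊆ cone d l := fun _ hx => hq.trans_le hx

/-- The cone is a countable union of the level sets with levels `1 / (n + 1)`. -/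
theorem exists_measure_le_kthLargest_pos {ν : RadonMeasure (cone d l)} (hν : ν.1 ≠ 0) :
    ∃ q : ℝ, 0 < q ∧
      0 < ν.1 (Subtype.val ⁻¹' {x : Fin d → ℝ≥0∞ | ENNReal.ofReal q ≤ kthLargest l x}) := by
  by_contra! hcon
  apply hν
  rw [← Measure.measure_univ_eq_zero]
  have hcov : (univ : Set (cone d l)) ⊆ ⋃ n : ℕ, Subtype.val ⁻¹'
      {x : Fin d → ℝ≥0∞ | ENNReal.ofReal (1 / ((n : ℝ) + 1)) ≤ kthLargest l x} := by
    intro x _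
    have hx : 0 < kthLargest l x.1 := x.2
    have hlim : Tendsto (fun n : ℕ => ENNReal.ofReal (1 / ((n : ℝ) + 1))) atTop (𝓝 0) := by
      rw [← ENNReal.ofReal_zero]
      exact ENNReal.tendsto_ofReal tendsto_one_div_add_atTop_nhds_zero_nat
    obtain ⟨n, hn⟩ := (hlim.eventually_lt_const hx).exists
    exact mem_iUnion.2 ⟨n, hn.le⟩
  exact measure_mono_null hcov (measure_iUnion_null fun n =>
    le_antisymm (hcon _ (by positivity)) zero_le)

/-- A scaling function of a regularly varying vector whose components have tails of order `1 / x`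
grows at most linearly. -/
theorem IsRegularlyVarying.exists_scaling_le (hl : 1 ≤ l) (ha : ∀ j, Tendsto (a j) atTop atTop)
    (htail : ∀ j, Tendsto (fun t => t * Q.real {z | t < standardize a z j}) atTop (𝓝 1))
    {ν : RadonMeasure (cone d l)} (h : IsRegularlyVarying l (Q.map (standardize a)) b ν) :
    ∃ C : ℝ, ∀ᶠ t in atTop, b t ≤ C * t := by
  obtain ⟨q, hq, hνq⟩ := exists_measure_le_kthLargest_pos h.ne_zero
  obtain ⟨c, hc0, hcν⟩ := ENNReal.lt_iff_exists_nnreal_btwn.1 hνq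
  have hc : 0 < (c : ℝ) := by exact_mod_cast hc0
  set p := q / 2 with hp
  have hp0 : 0 < p := half_pos hq
  have hpq : ENNReal.ofReal p < ENNReal.ofReal q :=
    (ENNReal.ofReal_lt_ofReal_iff hq).2 (half_lt_self hq)
  have hev := eventually_lt_measure_of_tendsto_traceOn (isOpen_cone d l) (h.tendsto_traceOn ha)
    (isClosed_le_kthLargest hl _) (isOpen_lt_kthLargest hl (ENNReal.ofReal p))
    (fun x hx => hpq.trans_le hx) (le_kthLargest_subset_cone (ENNReal.ofReal_pos.2 hq)) hcν
  have htail2 : ∀ᶠ s in atTop, ∀ j, s * Q.real {z | s < standardize a z j} < 2 :=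
    eventually_all.2 fun j => (htail j).eventually_lt_const one_lt_two
  -- With `V` the `l`-th largest component of `U`, one has `c < t P[V > p b(t)]`. Some component
  -- then exceeds `p b(t)`, so the union bound gives `c < t d · 2 / (p b(t))`.
  refine ⟨d * 2 / (p * c), ?_⟩
  filter_upwards [hev, (h.tendsto_atTop.atTop_mul_const hp0).eventually htail2,
    eventually_gt_atTop 0, h.tendsto_atTop.eventually_gt_atTop 0] with t ht htl ht0 hbt
  rw [smul_map_scaledPoint_apply ha ht0.le _ (isOpen_lt_kthLargest hl _).measurableSet,
    ← ENNReal.ofReal_coe_nnreal] at ht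
  have ht' := (ENNReal.ofReal_lt_ofReal_iff'.1 ht).1
  have hsum : Q.real {z | scaledPoint a (b t) z ∈
      {x : Fin d → ℝ≥0∞ | ENNReal.ofReal p < kthLargest l x}}
      ≤ ∑ j : Fin d, Q.real {z | b t * p < standardize a z j} := by
    refine (measureReal_mono ?_).trans
      (measureReal_iUnion_fintype_le fun j : Fin d => {z | b t * p < standardize a z j})
    intro z hz
    have hz' := (lt_kthLargest_iff hl).1 hz
    obtain ⟨j, hj⟩ := Finset.card_pos.1 (hl.trans hz')
    have hj' : ENNReal.ofReal p < ENNReal.ofReal (standardize a z j / b t) :=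
      (Finset.mem_filter.1 hj).2
    refine mem_iUnion.2 ⟨j, ?_⟩
    have := (lt_div_iff₀ hbt).1 (ENNReal.ofReal_lt_ofReal_iff'.1 hj').1
    simpa [mul_comm] using this
  have hbound : ∑ j : Fin d, Q.real {z | b t * p < standardize a z j} ≤ d * (2 / (b t * p)) := by
    refine (Finset.sum_le_card_nsmul _ _ (2 / (b t * p)) fun j _ => ?_).trans (by simp)
    rw [le_div_iff₀ (by positivity), mul_comm]
    exact (htl j).le
  have h3 : (c : ℝ) < t * (d * (2 / (b t * p))) :=
    ht'.trans_le (mul_le_mul_of_nonneg_left (hsum.trans hbound) ht0.le)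
  have h4 : t * (d * (2 / (b t * p))) = t * d * 2 / (b t * p) := by ring
  rw [h4, lt_div_iff₀ (by positivity)] at h3
  rw [div_mul_eq_mul_div, le_div_iff₀ (by positivity)]
  linarith

/-- If the scaling function is `o(t)`, the limit measure of the level sets of the `l`-th largest
component cannot stay at height one on an interval. -/
theorem IsRegularlyVarying.one_lt_measure_le_kthLargest (hl : 1 ≤ l)
    (ha : ∀ j, Tendsto (a j) atTop atTop)
    {ν : RadonMeasure (cone d l)} (h : IsRegularlyVarying l (Q.map (standardize a)) b ν)
    (hb : Tendsto (fun t => b t / t) atTop (𝓝 0)) {p q : ℝ} (hp : 0 < p) (hpq : p < q)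
    (hq : 1 ≤ ν.1 (Subtype.val ⁻¹' {x : Fin d → ℝ≥0∞ | ENNReal.ofReal q ≤ kthLargest l x})) :
    1 < ν.1 (Subtype.val ⁻¹' {x : Fin d → ℝ≥0∞ | ENNReal.ofReal p ≤ kthLargest l x}) := by
  by_contra! hcon
  obtain ⟨y₁, hpy₁, hy₁q⟩ := exists_between hpq
  obtain ⟨y₂, hy₁y₂, hy₂q⟩ := exists_between hy₁q
  have hy₁ : 0 < y₁ := hp.trans hpy₁
  have hy₂ : 0 < y₂ := hy₁.trans hy₁y₂
  have hq0 : 0 < q := hy₂.trans hy₂q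
  set lam := y₂ / y₁ with hlam
  have hlam1 : 1 < lam := (one_lt_div hy₁).2 hy₁y₂
  have hlam0 : 0 < lam := one_pos.trans hlam1
  set c := (1 + lam) / 2 with hcdef
  have hc1 : 1 < c := by rw [hcdef]; linarith
  have hcl : c < lam := by rw [hcdef]; linarith
  have hc0 : 0 < c := one_pos.trans hc1
  have hlower := eventually_lt_measure_of_tendsto_traceOn (isOpen_cone d l) (h.tendsto_traceOn ha)
    (isClosed_le_kthLargest hl _) (isOpen_lt_kthLargest hl (ENNReal.ofReal y₂))
    (fun x hx => ((ENNReal.ofReal_lt_ofReal_iff hq0).2 hy₂q).trans_le hx)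
    (le_kthLargest_subset_cone (ENNReal.ofReal_pos.2 hq0)) (c := ENNReal.ofReal (c / lam))
    (lt_of_lt_of_le (by rw [ENNReal.ofReal_lt_one]; exact (div_lt_one hlam0).2 hcl) hq)
  have hνp : ν.1 (Subtype.val ⁻¹' {x : Fin d → ℝ≥0∞ | ENNReal.ofReal p < kthLargest l x}) ≤ 1 :=
    le_trans (measure_mono fun x hx => by
      simp only [mem_preimage, mem_ofPred_eq] at hx ⊢
      exact hx.le) hcon
  have hupper := eventually_measure_lt_of_tendsto_traceOn (isOpen_cone d l) (h.tendsto_traceOn ha)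
    (isClosed_le_kthLargest hl (ENNReal.ofReal y₁)) (isOpen_lt_kthLargest hl (ENNReal.ofReal p))
    (fun x hx => ((ENNReal.ofReal_lt_ofReal_iff hy₁).2 hpy₁).trans_le hx)
    (le_kthLargest_subset_cone (ENNReal.ofReal_pos.2 hy₁)) (c := ENNReal.ofReal c)
    (hνp.trans_lt (ENNReal.one_lt_ofReal.2 hc1))
  -- With `V` the `l`-th largest component of `U`, `P[V > y₂ b(t)] > c / (λt) > P[V ≥ y₁ b(λt)]`. If
  -- `b(λt) < λ b(t)`, then `y₁ b(λt) < y₂ b(t)`, because `λ = y₂ / y₁`, and the first event would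
  -- lie in the second.
  have hgrow : ∀ᶠ t in atTop, lam * b t ≤ b (lam * t) := by
    filter_upwards [hlower, (tendsto_id.const_mul_atTop hlam0).eventually hupper,
      eventually_gt_atTop 0, h.tendsto_atTop.eventually_gt_atTop 0,
      (h.tendsto_atTop.comp (tendsto_id.const_mul_atTop hlam0)).eventually_gt_atTop 0]
      with t htl htu ht0 hbt hbt'
    simp only [id, Function.comp] at htu hbt'
    by_contra! hlt
    have hlt0 : 0 < lam * t := by positivity
    rw [smul_map_scaledPoint_apply ha ht0.le _ (isOpen_lt_kthLargest hl _).measurableSet] at htl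
    rw [smul_map_scaledPoint_apply ha hlt0.le _ (isClosed_le_kthLargest hl _).measurableSet] at htu
    have htl' := (ENNReal.ofReal_lt_ofReal_iff'.1 htl).1
    have htu' := (ENNReal.ofReal_lt_ofReal_iff'.1 htu).1
    have hsub : Q.real {z | scaledPoint a (b t) z ∈
          {x : Fin d → ℝ≥0∞ | ENNReal.ofReal y₂ < kthLargest l x}}
        ≤ Q.real {z | scaledPoint a (b (lam * t)) z ∈
          {x : Fin d → ℝ≥0∞ | ENNReal.ofReal y₁ ≤ kthLargest l x}} := by
      refine measureReal_mono fun z hz => ?_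
      have hz' := (lt_kthLargest_iff hl).1 hz
      refine (le_kthLargest_iff (ENNReal.ofReal_pos.2 hy₁)).2
        (hz'.trans (Finset.card_le_card fun j hj => ?_))
      have hj₂ : ENNReal.ofReal y₂ < ENNReal.ofReal (standardize a z j / b t) :=
        (Finset.mem_filter.1 hj).2
      have hj' := (lt_div_iff₀ hbt).1 (ENNReal.ofReal_lt_ofReal_iff'.1 hj₂).1
      refine Finset.mem_filter.2 ⟨Finset.mem_univ _, ?_⟩
      refine ENNReal.ofReal_le_ofReal ((le_div_iff₀ hbt').2 (le_trans ?_ hj'.le))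
      have : y₁ * (lam * b t) = y₂ * b t := by rw [hlam]; field_simp
      rw [← this]
      exact mul_le_mul_of_nonneg_left hlt.le hy₁.le
    rw [div_lt_iff₀ hlam0] at htl'
    have := mul_le_mul_of_nonneg_left hsub hlt0.le
    nlinarith
  obtain ⟨T, hT⟩ := eventually_atTop.1 ((hgrow.and (eventually_gt_atTop 0)).and
    (h.tendsto_atTop.eventually_gt_atTop 0))
  have hT0 : 0 < T := (hT T le_rfl).1.2
  have hbT : 0 < b T := (hT T le_rfl).2
  have hpowT : ∀ n : ℕ, T ≤ lam ^ n * T := fun n =>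
    le_mul_of_one_le_left hT0.le (one_le_pow₀ hlam1.le)
  have hiter : ∀ n : ℕ, lam ^ n * b T ≤ b (lam ^ n * T) := by
    intro n
    induction n with
    | zero => simp
    | succ n ih =>
      have h1 := (hT _ (hpowT n)).1.1
      rw [pow_succ', mul_assoc, mul_assoc]
      exact (mul_le_mul_of_nonneg_left ih hlam0.le).trans h1
  have hlim : Tendsto (fun n : ℕ => lam ^ n * T) atTop atTop :=
    (tendsto_pow_atTop_atTop_of_one_lt hlam1).atTop_mul_const hT0
  -- Along `λⁿ T` the ratio `b(t)/t` never drops below `b(T)/T`, contradicting `b(t)/t → 0`.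
  obtain ⟨n, hn⟩ := ((hb.comp hlim).eventually_lt_const (div_pos hbT hT0)).exists
  simp only [Function.comp] at hn
  have hpow : 0 < lam ^ n := by positivity
  rw [div_lt_div_iff₀ (by positivity) hT0] at hn
  nlinarith [hiter n]

end ScalingFunction

/-! ### Uniform closeness in a compact space, through ultrafilters. -/

section AsymptoticEquality

variable {α E : Type*} [TopologicalSpace E]

/-- Two families of points are asymptotically equal along a filter if they have the same limits
along every finer ultrafilter. In a compact Hausdorff space this says that the pairs approach the
diagonal. -/
def AsympEq (F : Filter α) (x w : α → E) : Prop :=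
  ∀ U : Ultrafilter α, ↑U ≤ F → ∀ y, Tendsto x U (𝓝 y) → Tendsto w U (𝓝 y)

theorem exists_tendsto_ultrafilter [CompactSpace E] (U : Ultrafilter α) (x : α → E) :
    ∃ y, Tendsto x U (𝓝 y) := by
  obtain ⟨y, -, hy⟩ := isCompact_univ.ultrafilter_le_nhds (U.map x) (by simp)
  exact ⟨y, hy⟩

/-- Along every ultrafilter the pair converges to a point of the diagonal. This gives uniform
estimates without choosing a metric on `[0,∞]^d`. -/
theorem AsympEq.eventually_mem [CompactSpace E] {F : Filter α} {x w : α → E} (h : AsympEq F x w)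
    {N : Set (E × E)} (hN : IsOpen N) (hdiag : ∀ y, (y, y) ∈ N) : ∀ᶠ i in F, (x i, w i) ∈ N := by
  have : Tendsto (fun i => (x i, w i)) F (𝓟 N) := by
    rw [tendsto_iff_ultrafilter]
    intro U hU
    obtain ⟨y, hy⟩ := exists_tendsto_ultrafilter U x
    exact tendsto_principal.2 ((hy.prodMk_nhds (h U hU y hy)).eventually_mem
      (hN.mem_nhds (hdiag y)))
  exact tendsto_principal.1 this

/-- If two ultrafilter limits differed in a coordinate, finite levels `0 < p < q` strictly between
the two values would violate one of the hypotheses; the coordinates `0` and `∞` need no separate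
treatment. -/
theorem asympEq_of_order {ι : Type*} {F : Filter α} {x w : α → ι → ℝ≥0∞}
    (h₁ : ∀ p q : ℝ≥0, 0 < p → p < q → ∀ j, ∀ᶠ i in F, x i j ≤ p → w i j < q)
    (h₂ : ∀ p q : ℝ≥0, 0 < p → p < q → ∀ j, ∀ᶠ i in F, w i j ≤ p → x i j < q) :
    AsympEq F x w := by
  have key : ∀ (U : Ultrafilter α), ↑U ≤ F → ∀ (u v : α → ι → ℝ≥0∞)
      (_ : ∀ p q : ℝ≥0, 0 < p → p < q → ∀ j, ∀ᶠ i in F, u i j ≤ p → v i j < q)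
      (y y' : ι → ℝ≥0∞), Tendsto u U (𝓝 y) → Tendsto v U (𝓝 y') → ∀ j, y' j ≤ y j := by
    intro U hU u v huv y y' hu hv j
    by_contra! hlt
    obtain ⟨p, hyp, hpy⟩ := ENNReal.lt_iff_exists_nnreal_btwn.1 hlt
    obtain ⟨q, hpq, hqy⟩ := ENNReal.lt_iff_exists_nnreal_btwn.1 hpy
    have hp : 0 < p := ENNReal.coe_pos.1 hyp.bot_lt
    obtain ⟨i, ⟨hi₁, hi₂⟩, hi₃⟩ := ((((tendsto_pi_nhds.1 hu j).eventually_lt_const hyp).and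
      ((tendsto_pi_nhds.1 hv j).eventually_const_lt hqy)).and
      ((huv p q hp (by exact_mod_cast hpq) j).filter_mono hU)).exists
    exact absurd (hi₃ hi₁.le) hi₂.not_gt
  intro U hU y hy
  obtain ⟨y', hy'⟩ := exists_tendsto_ultrafilter U w
  have : y' = y := funext fun j =>
    le_antisymm (key U hU x w h₁ y y' hy hy' j) (key U hU w x h₂ y' y hy' hy j)
  rwa [← this]

theorem AsympEq.div_of_tendsto_one {ι : Type*} {F : Filter α} {x w : α → ι → ℝ≥0∞}
    (h : AsympEq F x w) {c : α → ℝ≥0∞} (hc : Tendsto c F (𝓝 1)) :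
    AsympEq F x fun i j => w i j / c i := by
  intro U hU y hy
  rw [tendsto_pi_nhds]
  intro j
  have := ENNReal.Tendsto.div (tendsto_pi_nhds.1 (h U hU y hy) j) (Or.inr one_ne_zero)
    (hc.mono_left hU) (Or.inl ENNReal.one_ne_top)
  simpa using this

end AsymptoticEquality

/-! ### Point measures of triangular arrays under small displacements. -/

section Rows

variable {α : Type*} {n : α → ℕ} {L : Filter α}

/-- This filter encodes uniformity over all points of a row. -/
theorem eventually_comap_sigma_fst {p : (Σ x, Fin (n x)) → Prop} :
    (∀ᶠ y in L.comap Sigma.fst, p y) ↔ ∀ᶠ x in L, ∀ i, p ⟨x, i⟩ := by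
  rw [eventually_comap]
  refine eventually_congr (Eventually.of_forall fun x => ⟨fun h i => h _ rfl, ?_⟩)
  rintro h ⟨_, i⟩ rfl
  exact h i

/-- The measure `c⁻¹ ∑ᵢ ε_{xᵢ}`. -/
noncomputable def pointMeasure {E : Type*} [MeasurableSpace E] {m : ℕ} (c : ℝ≥0)
    (x : Fin m → E) : Measure E :=
  c⁻¹ • ∑ i, Measure.dirac (x i)

instance {E : Type*} [MeasurableSpace E] {m : ℕ} (c : ℝ≥0) (x : Fin m → E) :
    IsFiniteMeasure (pointMeasure c x) := by
  unfold pointMeasure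
  infer_instance

theorem lintegral_pointMeasure {E : Type*} [MeasurableSpace E] [MeasurableSingletonClass E]
    {m : ℕ} (c : ℝ≥0) (x : Fin m → E) (h : E → ℝ≥0∞) :
    ∫⁻ y, h y ∂(pointMeasure c x) = (c⁻¹ : ℝ≥0) * ∑ i, h (x i) := by
  rw [pointMeasure, lintegral_smul_measure, lintegral_finsetSum_measure]
  simp only [lintegral_dirac]
  rfl

theorem pointMeasure_apply {E : Type*} [MeasurableSpace E] {m : ℕ} (c : ℝ≥0) (x : Fin m → E)
    {p : E → Prop} [DecidablePred p] (hp : MeasurableSet {y | p y}) :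
    pointMeasure c x {y | p y}
      = ((c⁻¹ * (Finset.univ.filter fun i => p (x i)).card : ℝ≥0) : ℝ≥0∞) := by
  rw [pointMeasure, Measure.smul_apply, Measure.finsetSum_apply]
  simp only [Measure.dirac_apply' _ hp, indicator, mem_ofPred_eq, Pi.one_apply]
  rw [Finset.sum_boole]
  push_cast
  rfl

variable {d l : ℕ} {X W : (Σ x, Fin (n x)) → Fin d → ℝ≥0∞} {ν : RadonMeasure (cone d l)}

/-- Vague convergence of point measures is not affected by an asymptotically negligible
perturbation of the points. -/
theorem tendsto_traceOn_pointMeasure_of_asympEq (hl : 1 ≤ l) {c : α → ℝ≥0}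
    (hX : Tendsto (fun x => traceOn (cone d l) (pointMeasure (c x) fun i => X ⟨x, i⟩)) L (𝓝 ν))
    (h : AsympEq (L.comap Sigma.fst) X W) :
    Tendsto (fun x => traceOn (cone d l) (pointMeasure (c x) fun i => W ⟨x, i⟩)) L (𝓝 ν) := by
  rw [tendsto_radonMeasure_iff]
  intro f
  have hXf := tendsto_radonMeasure_iff.1 hX f
  obtain ⟨δ, hδ0, hδ, hfδ⟩ := exists_le_kthLargest_of_extendZero_ne_zero hl f
  -- The margin between `r` and `δ` ensures that a displaced point in the support of `f` comes from
  -- a point with `l`-th largest component above `r`. The normalized number of such points is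
  -- eventually below `C`.
  set r := δ / 2 with hr
  have hrδ : r < δ := ENNReal.half_lt_self hδ0.ne' hδ
  have hr0 : 0 < r := ENNReal.half_pos hδ0.ne'
  obtain ⟨g, hg⟩ := exists_compactlySupported_between (isOpen_cone d l)
    (isClosed_le_kthLargest hl r) (isOpen_cone d l) (le_kthLargest_subset_cone hr0)
    (le_kthLargest_subset_cone hr0)
  set C := ∫⁻ x, g x ∂ν.1 + 1 with hC
  have hCtop : C ≠ ∞ := ENNReal.add_ne_top.2 ⟨ν.lintegral_ne_top g, ENNReal.one_ne_top⟩
  have hC0 : C ≠ 0 := by simp [hC]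
  have hcount : ∀ᶠ x in L, (pointMeasure (c x) fun i => X ⟨x, i⟩)
      {y : Fin d → ℝ≥0∞ | r ≤ kthLargest l y} < C := by
    filter_upwards [(tendsto_radonMeasure_iff.1 hX g).eventually_lt_const
      (ENNReal.lt_add_right (ν.lintegral_ne_top g) one_ne_zero)] with x hx
    have := (hg (traceOn (cone d l) (pointMeasure (c x) fun i => X ⟨x, i⟩)).1).1.trans_lt hx
    rwa [traceOn_apply (isOpen_cone d l), Subtype.image_preimage_coe,
      inter_eq_right.2 (le_kthLargest_subset_cone hr0)] at this
  have hV := continuous_kthLargest (ι := Fin d) hl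
  have hnear := eventually_comap_sigma_fst.1 (h.eventually_mem
    (N := {y | kthLargest l y.2 < δ} ∪ {y | r < kthLargest l y.1})
    ((isOpen_lt (hV.comp continuous_snd) continuous_const).union
      (isOpen_lt continuous_const (hV.comp continuous_fst)))
    (fun y => by
      rcases lt_or_ge (kthLargest l y) δ with hy | hy
      · exact Or.inl hy
      · exact Or.inr (hrδ.trans_le hy)))
  have main : ∀ ε : ℝ≥0, 0 < ε → ∀ᶠ x in L,
      ∫⁻ y, f y ∂(traceOn (cone d l) (pointMeasure (c x) fun i => W ⟨x, i⟩)).1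
        ≤ ∫⁻ y, f y ∂(traceOn (cone d l) (pointMeasure (c x) fun i => X ⟨x, i⟩)).1 + ε * C ∧
      ∫⁻ y, f y ∂(traceOn (cone d l) (pointMeasure (c x) fun i => X ⟨x, i⟩)).1
        ≤ ∫⁻ y, f y ∂(traceOn (cone d l) (pointMeasure (c x) fun i => W ⟨x, i⟩)).1 + ε * C := by
    intro ε hε
    have hf := continuous_extendZero f
    have hclose := eventually_comap_sigma_fst.1 (h.eventually_mem
      (N := {y | dist (extendZero f y.1) (extendZero f y.2) < ε})
      (isOpen_lt ((hf.comp continuous_fst).dist (hf.comp continuous_snd)) continuous_const)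
      (fun y => by simpa using hε))
    filter_upwards [hcount, hnear, hclose] with x hx₁ hx₂ hx₃
    set I : Fin (n x) → ℝ≥0∞ :=
      fun i => {y : Fin d → ℝ≥0∞ | r ≤ kthLargest l y}.indicator 1 (X ⟨x, i⟩) with hI
    -- Each relevant point changes `f` by at most `ε`, so the total error is `ε` times the bounded
    -- normalized count.
    have hIsum : ε * ((c x)⁻¹ : ℝ≥0) * ∑ i, I i ≤ ε * C := by
      rw [mul_assoc]
      refine mul_le_mul_right (le_trans (le_of_eq ?_) hx₁.le) _
      rw [← lintegral_indicator_one (isClosed_le_kthLargest hl r).measurableSet,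
        lintegral_pointMeasure]
    have hpt : ∀ i, (extendZero f (W ⟨x, i⟩) : ℝ≥0∞) ≤ extendZero f (X ⟨x, i⟩) + ε * I i ∧
        (extendZero f (X ⟨x, i⟩) : ℝ≥0∞) ≤ extendZero f (W ⟨x, i⟩) + ε * I i := by
      intro i
      by_cases hi : r ≤ kthLargest l (X ⟨x, i⟩)
      · have hIi : I i = 1 := by simp [hI, hi]
        have hd : |(extendZero f (X ⟨x, i⟩) : ℝ) - extendZero f (W ⟨x, i⟩)| < ε := hx₃ i
        rw [abs_lt] at hd
        rw [hIi, mul_one]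
        constructor
        · have : extendZero f (W ⟨x, i⟩) ≤ extendZero f (X ⟨x, i⟩) + ε :=
            NNReal.coe_le_coe.1 (by push_cast; linarith)
          exact_mod_cast this
        · have : extendZero f (X ⟨x, i⟩) ≤ extendZero f (W ⟨x, i⟩) + ε :=
            NNReal.coe_le_coe.1 (by push_cast; linarith)
          exact_mod_cast this
      · have h1 : extendZero f (X ⟨x, i⟩) = 0 := by
          by_contra hne
          exact hi (hrδ.le.trans (hfδ _ hne))
        have h2 : extendZero f (W ⟨x, i⟩) = 0 := by
          by_contra hne
          rcases hx₂ i with h3 | h3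
          · exact absurd (hfδ _ hne) (not_le.2 h3)
          · exact hi (le_of_lt h3)
        simp [h1, h2]
    simp only [lintegral_traceOn, lintegral_pointMeasure]
    have hsum : ∀ u v : Fin (n x) → ℝ≥0∞, (∀ i, u i ≤ v i + ε * I i) →
        ((c x)⁻¹ : ℝ≥0) * ∑ i, u i ≤ ((c x)⁻¹ : ℝ≥0) * ∑ i, v i + ε * C := by
      intro u v huv
      refine le_trans (mul_le_mul_right (Finset.sum_le_sum fun i _ => huv i) _) ?_
      rw [Finset.sum_add_distrib, mul_add, ← Finset.mul_sum, mul_left_comm, ← mul_assoc]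
      gcongr
    exact ⟨hsum _ _ fun i => (hpt i).1, hsum _ _ fun i => (hpt i).2⟩
  rw [ENNReal.tendsto_nhds (ν.lintegral_ne_top f)] at hXf ⊢
  intro ε hε
  obtain ⟨η, hη0, hη⟩ : ∃ η : ℝ≥0, 0 < η ∧ (η : ℝ≥0∞) * C ≤ ε / 2 := by
    rcases eq_or_ne ε ∞ with rfl | hεt
    · exact ⟨1, one_pos, by simp [ENNReal.top_div]⟩
    · have hne : ε / 2 / C ≠ ∞ := by
        exact (ENNReal.div_lt_top (ENNReal.div_ne_top hεt two_ne_zero) hC0).ne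
      refine ⟨(ε / 2 / C).toNNReal, ?_, ?_⟩
      · exact ENNReal.toNNReal_pos (ENNReal.div_pos (ENNReal.half_pos hε.ne').ne' hCtop).ne' hne
      · rw [ENNReal.coe_toNNReal hne, ENNReal.div_mul_cancel hC0 hCtop]
  filter_upwards [hXf (ε / 2) (ENNReal.half_pos hε.ne'), main η hη0] with x hx₁ hx₂
  constructor
  · rw [tsub_le_iff_right]
    calc _ ≤ _ + ε / 2 := tsub_le_iff_right.1 hx₁.1
      _ ≤ _ + ε / 2 + ε / 2 := by gcongr; exact hx₂.2.trans (by gcongr)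
      _ = _ := by rw [add_assoc, ENNReal.add_halves]
  · calc _ ≤ _ + ε / 2 := hx₂.1.trans (by gcongr)
      _ ≤ _ + ε / 2 + ε / 2 := by gcongr; exact hx₁.2
      _ = _ := by rw [add_assoc, ENNReal.add_halves]

/-- The `k`-th largest of the values of the `l`-th largest component converges to the level at
which the limit measure has mass one. -/
theorem tendsto_kthLargest_of_asympEq (hl : 1 ≤ l) {k : α → ℕ} (hk : ∀ᶠ x in L, 0 < k x)
    (hX : Tendsto (fun x => traceOn (cone d l) (pointMeasure (k x) fun i => X ⟨x, i⟩)) L (𝓝 ν))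
    (h : AsympEq (L.comap Sigma.fst) X W)
    (hlow : ∀ p : ℝ≥0∞, 0 < p → p < 1 →
      1 < ν.1 (Subtype.val ⁻¹' {x : Fin d → ℝ≥0∞ | p ≤ kthLargest l x}))
    (hupp : ∀ q : ℝ≥0∞, 1 < q →
      ν.1 (Subtype.val ⁻¹' {x : Fin d → ℝ≥0∞ | q < kthLargest l x}) < 1) :
    Tendsto (fun x => kthLargest (k x) fun i => kthLargest l (W ⟨x, i⟩)) L (𝓝 1) := by
  classical
  have hV := continuous_kthLargest (ι := Fin d) hl
  rw [tendsto_order]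
  constructor
  · intro a ha
    -- Of the levels `a < a₀ < p' < p < 1`, the gap `(p', p)` is for the portmanteau inequality,
    -- `(a₀, p')` for the displacement from `X` to `W`, and `(a, a₀)` for strictness.
    obtain ⟨a₀, haa, ha₀⟩ := exists_between ha
    obtain ⟨p', ha₀p', hp'⟩ := exists_between ha₀
    obtain ⟨p, hp'p, hp⟩ := exists_between hp'
    have hnear := eventually_comap_sigma_fst.1 (h.eventually_mem
      (N := {y | kthLargest l y.1 < p'} ∪ {y | a₀ < kthLargest l y.2})
      ((isOpen_lt (hV.comp continuous_fst) continuous_const).union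
        (isOpen_lt continuous_const (hV.comp continuous_snd)))
      (fun y => by
        rcases lt_or_ge (kthLargest l y) p' with hy | hy
        · exact Or.inl hy
        · exact Or.inr (ha₀p'.trans_le hy)))
    filter_upwards [hnear, hk, eventually_lt_measure_of_tendsto_traceOn (isOpen_cone d l) hX
      (isClosed_le_kthLargest hl p) (isOpen_lt_kthLargest hl p') (fun x hx => hp'p.trans_le hx)
      (le_kthLargest_subset_cone hp'p.bot_lt) (hlow p hp'p.bot_lt hp)] with x hx hkx hcount
    refine haa.trans_le ((le_kthLargest_iff haa.bot_lt).2 ?_)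
    rw [pointMeasure_apply _ _ (isOpen_lt_kthLargest hl p').measurableSet] at hcount
    have hcount' : (1 : ℝ≥0) < (k x : ℝ≥0)⁻¹ * (Finset.univ.filter fun i =>
        p' < kthLargest l (X ⟨x, i⟩)).card := by exact_mod_cast hcount
    have hk0 : (0 : ℝ≥0) < k x := by exact_mod_cast hkx
    rw [inv_mul_eq_div, one_lt_div hk0] at hcount'
    refine le_trans (le_of_lt (by exact_mod_cast hcount')) (Finset.card_le_card fun i hi => ?_)
    simp only [Finset.mem_filter, Finset.mem_univ, true_and] at hi ⊢
    rcases hx i with h1 | h1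
    · exact absurd h1 (not_lt.2 hi.le)
    · exact le_of_lt h1
  · intro a ha
    obtain ⟨a₀, ha₀, haa⟩ := exists_between ha
    obtain ⟨q, hq, hqa⟩ := exists_between ha₀
    obtain ⟨q₀, hq₀, hq₀q⟩ := exists_between hq
    have hnear := eventually_comap_sigma_fst.1 (h.eventually_mem
      (N := {y | kthLargest l y.2 < a₀} ∪ {y | q < kthLargest l y.1})
      ((isOpen_lt (hV.comp continuous_snd) continuous_const).union
        (isOpen_lt continuous_const (hV.comp continuous_fst)))
      (fun y => by
        rcases lt_or_ge (kthLargest l y) a₀ with hy | hy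
        · exact Or.inl hy
        · exact Or.inr (hqa.trans_le hy)))
    filter_upwards [hnear, hk, eventually_measure_lt_of_tendsto_traceOn (isOpen_cone d l) hX
      (isClosed_le_kthLargest hl q) (isOpen_lt_kthLargest hl q₀) (fun x hx => hq₀q.trans_le hx)
      (le_kthLargest_subset_cone hq₀q.bot_lt) (hupp q₀ hq₀)] with x hx hkx hcount
    refine lt_of_not_ge fun hge => ?_
    have hcard := (le_kthLargest_iff ha₀.bot_lt).1 (haa.le.trans hge)
    rw [pointMeasure_apply _ _ (isClosed_le_kthLargest hl q).measurableSet] at hcount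
    have hcount' : (k x : ℝ≥0)⁻¹ * (Finset.univ.filter fun i =>
        q ≤ kthLargest l (X ⟨x, i⟩)).card < (1 : ℝ≥0) := by exact_mod_cast hcount
    have hk0 : (0 : ℝ≥0) < k x := by exact_mod_cast hkx
    rw [inv_mul_eq_div, div_lt_one hk0] at hcount'
    refine absurd (hcard.trans (Finset.card_le_card fun i hi => ?_))
      (not_le.2 (by exact_mod_cast hcount'))
    simp only [Finset.mem_filter, Finset.mem_univ, true_and] at hi ⊢
    rcases hx i with h1 | h1
    · exact absurd hi (not_le.2 h1)
    · exact le_of_lt h1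

end Rows

/-! ### Anti-ranks against counts of standardized observations; measurability. -/

section Ranks

variable {d n : ℕ}

theorem antiRank_pos (z : Fin n → Fin d → ℝ≥0) (i : Fin n) (j : Fin d) : 0 < antiRank z i j :=
  Finset.card_pos.2 ⟨i, by simp⟩

theorem ofReal_mul_invRank (z : Fin n → Fin d → ℝ≥0) (i : Fin n) (j : Fin d) {s : ℝ}
    (hs : 0 ≤ s) : ENNReal.ofReal s * invRank z i j = ENNReal.ofReal (s / antiRank z i j) := by
  have h : (0 : ℝ) < antiRank z i j := by exact_mod_cast antiRank_pos z i j
  rw [div_eq_mul_inv, ENNReal.ofReal_mul hs, ENNReal.ofReal_inv_of_pos h, ENNReal.ofReal_natCast]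
  rfl

/-- The inverse is monotone but may identify distinct observations, so counts for `U` only bracket
the ranks of `Z`: strict exceedances from below, weak ones from above. -/
theorem card_lt_standardize_le_antiRank {a : Fin d → ℝ → ℝ} {j : Fin d}
    (ha : Tendsto (a j) atTop atTop) (z : Fin n → Fin d → ℝ≥0) (i : Fin n) {s : ℝ}
    (h : standardize a (z i) j ≤ s) :
    (Finset.univ.filter fun p => s < standardize a (z p) j).card ≤ antiRank z i j := by
  refine Finset.card_le_card fun p hp => ?_
  simp only [Finset.mem_filter, Finset.mem_univ, true_and] at hp ⊢
  have := (monotone_leftInverse ha).reflect_lt (h.trans_lt hp)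
  exact_mod_cast this.le

theorem antiRank_le_card_le_standardize {a : Fin d → ℝ → ℝ} {j : Fin d}
    (ha : Tendsto (a j) atTop atTop) (z : Fin n → Fin d → ℝ≥0) (i : Fin n) {s : ℝ}
    (h : s ≤ standardize a (z i) j) :
    antiRank z i j ≤ (Finset.univ.filter fun p => s ≤ standardize a (z p) j).card := by
  refine Finset.card_le_card fun p hp => ?_
  simp only [Finset.mem_filter, Finset.mem_univ, true_and] at hp ⊢
  exact h.trans (monotone_leftInverse ha (by exact_mod_cast hp))

theorem measurable_antiRank : Measurable (antiRank : (Fin n → Fin d → ℝ≥0) → Fin n → Fin d → ℕ) := by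
  refine measurable_pi_lambda _ fun i => measurable_pi_lambda _ fun j => ?_
  simp only [antiRank, Finset.card_filter]
  refine Finset.measurable_sum _ fun p _ => Measurable.ite (measurableSet_le ?_ ?_)
    measurable_const measurable_const <;> fun_prop

/-- The estimator factors through the matrix of anti-ranks, which lives in a countable discrete
space where every map is measurable. -/
theorem measurable_rankEstimator (l k : ℕ) :
    Measurable (rankEstimator l k : (Fin n → Fin d → ℝ≥0) → RadonMeasure (cone d l)) := by
  let G : (Fin n → Fin d → ℕ) → RadonMeasure (cone d l) := fun r =>
    traceOn (cone d l) (pointMeasure (k : ℝ≥0) fun i j => (r i j : ℝ≥0∞)⁻¹ /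
      kthLargest k fun i => kthLargest l fun j => (r i j : ℝ≥0∞)⁻¹)
  exact (Measurable.of_discrete (f := G)).comp measurable_antiRank

end Ranks

/-! ### Consistency of the scaled sample and its approximation by ranks. -/

section EmpiricalMeasures

variable {d l : ℕ} {Ω : Type*} [MeasurableSpace Ω] {P : Measure Ω} [IsProbabilityMeasure P]
  {Q : Measure (Fin d → ℝ≥0)} [IsProbabilityMeasure Q] {Z : ℕ → Ω → Fin d → ℝ≥0}
  {a : Fin d → ℝ → ℝ} {k : ℕ → ℕ} {b : ℝ → ℝ}

theorem tendsto_natCast_div_atTop (hk : Tendsto k atTop atTop)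
    (hkn : Tendsto (fun n => (k n : ℝ) / n) atTop (𝓝 0)) :
    Tendsto (fun n : ℕ => (n : ℝ) / k n) atTop atTop := by
  have h : Tendsto (fun n => (k n : ℝ) / n) atTop (𝓝[>] 0) := by
    refine tendsto_nhdsWithin_iff.2 ⟨hkn, ?_⟩
    filter_upwards [hk.eventually_gt_atTop 0, eventually_gt_atTop 0] with n h1 h2
    have h1' : (0 : ℝ) < k n := by exact_mod_cast h1
    have h2' : (0 : ℝ) < n := by exact_mod_cast h2
    exact div_pos h1' h2'
  refine h.inv_tendsto_nhdsGT_zero.congr fun n => ?_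
  simp

/-- Consistency of the empirical measure of the scaled standardized sample. -/
theorem tendsto_traceOn_pointMeasure_scaledPoint (hZ_law : ∀ i, HasLaw (Z i) Q P)
    (hZ_indep : iIndepFun Z P) (ha : ∀ j, Tendsto (a j) atTop atTop) {ν : RadonMeasure (cone d l)}
    (h : IsRegularlyVarying l (Q.map (standardize a)) b ν) (hk : Tendsto k atTop atTop)
    (hkn : Tendsto (fun n => (k n : ℝ) / n) atTop (𝓝 0)) :
    Tendsto (fun x : ℕ × Ω => traceOn (cone d l) (pointMeasure (k x.1 : ℝ≥0)
        fun i : Fin x.1 => scaledPoint a (b (x.1 / k x.1)) (Z i x.2)))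
      (probFilter P) (𝓝 ν) := by
  rw [tendsto_radonMeasure_iff]
  intro f
  obtain ⟨M, hM⟩ := exists_extendZero_le f
  have hmeas : ∀ n : ℕ, Measurable fun z => (extendZero f (scaledPoint a (b (n / k n)) z) : ℝ) :=
    fun n => NNReal.continuous_coe.measurable.comp
      ((continuous_extendZero f).measurable.comp (measurable_scaledPoint ha _))
  have hvague := ((tendsto_radonMeasure_iff.1 (h.tendsto_traceOn ha) f).comp
    (tendsto_natCast_div_atTop hk hkn))
  have hvague' := (ENNReal.tendsto_toReal (ν.lintegral_ne_top f)).comp hvague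
  have hlln := tendsto_probFilter_sum_div P Q Z hZ_law hZ_indep
    (fun n z => (extendZero f (scaledPoint a (b (n / k n)) z) : ℝ)) hmeas M
    (fun n z => NNReal.coe_nonneg _) (fun n z => NNReal.coe_le_coe.2 (hM _))
    (fun n => (k n : ℝ)) (tendsto_natCast_atTop_atTop.comp hk) (∫⁻ x, f x ∂ν.1).toReal
    (hvague'.congr fun n => by
      have h0 : (0 : ℝ) ≤ n / k n := by positivity
      simp only [Function.comp]
      rw [lintegral_traceOn, lintegral_smul_measure, lintegral_map
        (continuous_extendZero f).measurable.coe_nnreal_ennreal (measurable_scaledPoint ha _),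
        integral_eq_lintegral_of_nonneg_ae (ae_of_all _ fun z => NNReal.coe_nonneg _)
          (hmeas n).aestronglyMeasurable]
      simp only [ENNReal.ofReal_coe_nnreal]
      change (((n / k n : ℝ).toNNReal : ℝ≥0∞) * _).toReal = _
      rw [ENNReal.toReal_mul, ENNReal.coe_toReal, Real.coe_toNNReal _ h0])
  have hfin := ENNReal.tendsto_ofReal hlln
  rw [ENNReal.ofReal_toReal (ν.lintegral_ne_top f)] at hfin
  refine hfin.congr' ?_
  filter_upwards [(hk.comp (tendsto_fst_probFilter P)).eventually_gt_atTop 0] with x hx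
  have hkx : (0 : ℝ) < k x.1 := by exact_mod_cast hx
  have hkx' : (k x.1 : ℝ≥0) ≠ 0 := by exact_mod_cast hx.ne'
  rw [lintegral_traceOn, lintegral_pointMeasure, ENNReal.ofReal_div_of_pos hkx,
    ENNReal.ofReal_sum_of_nonneg fun _ _ => NNReal.coe_nonneg _, ENNReal.coe_inv hkx',
    ENNReal.div_eq_inv_mul]
  simp

/-- Weak law of large numbers for counts of exceedances. -/
theorem tendsto_card_div (hZ_law : ∀ i, HasLaw (Z i) Q P) (hZ_indep : iIndepFun Z P)
    {S : ℕ → Set (Fin d → ℝ≥0)} (hS : ∀ n, MeasurableSet (S n)) {r : ℕ → ℝ} {m : ℝ}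
    (hr : ∀ᶠ n in atTop, 0 < r n)
    (hc : Tendsto (fun n : ℕ => n / r n) atTop atTop)
    (hm : Tendsto (fun n => r n * Q.real (S n)) atTop (𝓝 m))
    [∀ n, DecidablePred (· ∈ S n)] :
    Tendsto (fun x : ℕ × Ω =>
      ((Finset.univ.filter fun i : Fin x.1 => Z i x.2 ∈ S x.1).card : ℝ) / (x.1 / r x.1))
      (probFilter P) (𝓝 m) := by
  have := tendsto_probFilter_sum_div P Q Z hZ_law hZ_indep
    (fun n => (S n).indicator fun _ => (1 : ℝ)) (fun n => measurable_const.indicator (hS n)) 1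
    (fun n z => indicator_nonneg (fun _ _ => zero_le_one) z)
    (fun n z => indicator_le_self' (fun _ _ => zero_le_one) z) (fun n => n / r n) hc m
    (hm.congr' (by
      filter_upwards [eventually_gt_atTop 0, hr] with n hn hrn
      have hn' : (0 : ℝ) < n := by exact_mod_cast hn
      rw [integral_indicator (hS n), setIntegral_const, smul_eq_mul, mul_one,
        div_div_cancel₀ hn'.ne']))
  refine this.congr fun x => ?_
  simp [indicator, Finset.sum_boole]

/-- After rescaling, the reciprocal anti-ranks are uniformly close to the scaled standardized
sample. -/
theorem asympEq_scaledPoint_invRank (hZ_law : ∀ i, HasLaw (Z i) Q P) (hZ_indep : iIndepFun Z P)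
    (ha : ∀ j, Tendsto (a j) atTop atTop) (hmono : ∀ j, MonotoneOn (a j) (Ioi 0))
    (htail : ∀ j, Tendsto (fun t => t * Q.real {z | a j t < z j}) atTop (𝓝 1))
    {r : ℕ → ℝ} (hr : Tendsto r atTop atTop) (hc : Tendsto (fun n : ℕ => n / r n) atTop atTop) :
    AsympEq ((probFilter P).comap Sigma.fst)
      (fun y : Σ x : ℕ × Ω, Fin x.1 => scaledPoint a (r y.1.1) (Z y.2 y.1.2))
      (fun y : Σ x : ℕ × Ω, Fin x.1 => fun j =>
        ENNReal.ofReal (y.1.1 / r y.1.1) * invRank (fun i : Fin y.1.1 => Z i y.1.2) y.2 j) := by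
  classical
  have hU : ∀ j, Measurable fun z : Fin d → ℝ≥0 => standardize a z j := fun j =>
    (measurable_pi_apply j).comp (measurable_standardize ha)
  have hpos : ∀ᶠ x in probFilter P, 0 < r x.1 ∧ 0 < x.1 / r x.1 :=
    (tendsto_fst_probFilter P).eventually
      ((hr.eventually_gt_atTop 0).and (hc.eventually_gt_atTop 0))
  refine asympEq_of_order ?_ ?_
  -- If `U_i^j ≤ r_n p`, the anti-rank is at least the number of strict exceedances of `r_n p`,
  -- about `(n/r_n)/p > (n/r_n)/q`. The count does not involve `i`, hence the uniformity.
  · intro p q hp hpq j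
    have hp' : (0 : ℝ) < p := hp
    have hpq' : (p : ℝ) < q := hpq
    have hcard := tendsto_card_div hZ_law hZ_indep
      (S := fun n => {z | r n * p < standardize a z j})
      (fun n => measurableSet_lt measurable_const (hU j)) (hr.eventually_gt_atTop 0) hc
      ((tendsto_mul_measure_standardize (ha j) (hmono j) (htail j) hp').1.comp hr)
    rw [eventually_comap_sigma_fst]
    filter_upwards [hpos, hcard.eventually_const_lt (inv_strictAnti₀ hp' hpq')] with x ⟨hx₁, hx₂⟩ hx₃
    intro i hi
    rw [ofReal_mul_invRank _ _ _ hx₂.le, ← ENNReal.ofReal_coe_nnreal,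
      ENNReal.ofReal_lt_ofReal_iff (hp'.trans hpq')]
    rw [← ENNReal.ofReal_coe_nnreal, scaledPoint,
      ENNReal.ofReal_le_ofReal_iff hp'.le, div_le_iff₀' hx₁] at hi
    have hle := card_lt_standardize_le_antiRank (ha j) (fun i : Fin x.1 => Z i x.2) i hi
    have hle' := (Nat.cast_le (α := ℝ)).2 hle
    have hrank : (0 : ℝ) < antiRank (fun i : Fin x.1 => Z i x.2) i j := by
      exact_mod_cast antiRank_pos _ i j
    rw [lt_div_iff₀ hx₂] at hx₃
    have h4 := hx₃.trans_le hle'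
    rw [div_lt_iff₀ hrank]
    rwa [inv_mul_lt_iff₀ (hp'.trans hpq')] at h4
  -- Conversely, `U_i^j ≥ r_n q` bounds the anti-rank by about `(n/r_n)/q < (n/r_n)/p`.
  · intro p q hp hpq j
    have hp' : (0 : ℝ) < p := hp
    have hpq' : (p : ℝ) < q := hpq
    have hq' : (0 : ℝ) < q := hp'.trans hpq'
    have hcard := tendsto_card_div hZ_law hZ_indep
      (S := fun n => {z | r n * q ≤ standardize a z j})
      (fun n => measurableSet_le measurable_const (hU j)) (hr.eventually_gt_atTop 0) hc
      ((tendsto_mul_measure_standardize (ha j) (hmono j) (htail j) hq').2.comp hr)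
    rw [eventually_comap_sigma_fst]
    filter_upwards [hpos, hcard.eventually_lt_const (inv_strictAnti₀ hp' hpq')] with x ⟨hx₁, hx₂⟩ hx₃
    intro i hi
    by_contra! hge
    rw [ofReal_mul_invRank _ _ _ hx₂.le, ← ENNReal.ofReal_coe_nnreal,
      ENNReal.ofReal_le_ofReal_iff hp'.le] at hi
    have hrank : (0 : ℝ) < antiRank (fun i : Fin x.1 => Z i x.2) i j := by
      exact_mod_cast antiRank_pos _ i j
    rw [← ENNReal.ofReal_coe_nnreal, scaledPoint] at hge
    have hge' := (ENNReal.ofReal_le_ofReal_iff'.1 hge).resolve_right (not_le.2 hq')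
    rw [le_div_iff₀' hx₁] at hge'
    have hle := antiRank_le_card_le_standardize (ha j) (fun i : Fin x.1 => Z i x.2) i hge'
    have hle' := (Nat.cast_le (α := ℝ)).2 hle
    rw [div_lt_iff₀ hx₂] at hx₃
    have h4 := hle'.trans_lt hx₃
    rw [div_le_iff₀ hrank] at hi
    rw [lt_inv_mul_iff₀ hp'] at h4
    exact absurd h4 (not_lt.2 hi)

end EmpiricalMeasures

/-! ### Assembly of the consistency theorem. -/

theorem proposition2 {d l : ℕ} (hl : 2 ≤ l) (hld : l ≤ d)
    {Ω : Type*} [MeasurableSpace Ω] (P : Measure Ω) [IsProbabilityMeasure P]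
    (Q : Measure (Fin d → ℝ≥0)) [IsProbabilityMeasure Q]
    (Z : ℕ → Ω → Fin d → ℝ≥0)
    (hZ_law : ∀ i, HasLaw (Z i) Q P) (hZ_indep : iIndepFun Z P)
    (a : Fin d → ℝ → ℝ) (ν : RadonMeasure (cone d 1))
    (hQ : IsNonstandardRegularlyVarying Q a ν)
    (bl : ℝ → ℝ) (νl : RadonMeasure (cone d l))
    (hHRV : HasHiddenRegularVariation l Q a bl νl)
    (hνl : νl.1 (aleph d l) = 1)
    (k : ℕ → ℕ) (hk : Tendsto k atTop atTop)
    (hkn : Tendsto (fun n => (k n : ℝ) / n) atTop (𝓝 0)) :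
    TendstoInDistribution
      (fun (n : ℕ) (ω : Ω) => rankEstimator l (k n) fun i : Fin n => Z i ω)
      atTop (fun _ : Ω => νl) (fun _ => P) P := by
  have hl1 : 1 ≤ l := one_le_two.trans hl
  have ha := hQ.tendsto_atTop
  have hmono := hQ.monotone
  have htail : ∀ j, Tendsto (fun t => t * Q.real {z | a j t < z j}) atTop (𝓝 1) := fun j => by
    obtain ⟨β, hβ, h⟩ := hQ.marginals j
    exact tendsto_mul_measure_scaling_lt (ha j) hβ h
  have hRV := hHRV.regularlyVarying
  -- Write `bl/t = (bi/t)(bl/bi)`: the first factor is bounded and the second tends to zero.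
  have hbl : Tendsto (fun t => bl t / t) atTop (𝓝 0) := by
    obtain ⟨i, bi, νi, hi, -, -, hRVi, -, -, hratio⟩ := hHRV.hidden
    obtain ⟨C, hC⟩ := hRVi.exists_scaling_le hi ha fun j => by
      simpa using (tendsto_mul_measure_standardize (ha j) (hmono j) (htail j) one_pos).1
    have hlim := (tendsto_inv_atTop_zero.comp hratio).const_mul C
    rw [mul_zero] at hlim
    refine tendsto_of_tendsto_of_tendsto_of_le_of_le' tendsto_const_nhds hlim ?_ ?_
    · filter_upwards [hRV.tendsto_atTop.eventually_gt_atTop 0, eventually_gt_atTop 0] with t h1 h2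
      exact (div_pos h1 h2).le
    · filter_upwards [hRV.tendsto_atTop.eventually_gt_atTop 0, eventually_gt_atTop 0, hC,
        hRVi.tendsto_atTop.eventually_gt_atTop 0] with t h1 h2 h3 h4
      simp only [Function.comp, inv_div]
      rw [← mul_div_assoc, div_le_div_iff₀ h2 h4]
      nlinarith
  have hnk := tendsto_natCast_div_atTop hk hkn
  set r : ℕ → ℝ := fun n => bl (n / k n) with hrdef
  have hr : Tendsto r atTop atTop := hRV.tendsto_atTop.comp hnk
  -- The bound `r_n ≤ n/k` gives `n/r_n ≥ k`. Marginal counts are normed by `n/r_n`, not by `k`.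
  have hc : Tendsto (fun n : ℕ => n / r n) atTop atTop := by
    have hpos : ∀ᶠ n : ℕ in atTop, r n / (n / k n) ≤ 1 :=
      ((hbl.comp hnk).eventually_lt_const one_pos).mono fun n hn => hn.le
    refine tendsto_atTop_mono' atTop ?_ (tendsto_natCast_atTop_atTop.comp hk)
    filter_upwards [hpos, hr.eventually_gt_atTop 0, hnk.eventually_gt_atTop 0,
      hk.eventually_gt_atTop 0] with n h1 h2 h3 h4
    have hkn0 : (0 : ℝ) < k n := by exact_mod_cast h4
    rw [div_le_one h3, le_div_iff₀ hkn0] at h1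
    simp only [Function.comp]
    rw [le_div_iff₀ h2]
    linarith
  have hX := tendsto_traceOn_pointMeasure_scaledPoint hZ_law hZ_indep ha hRV hk hkn
  have hnear := asympEq_scaledPoint_invRank hZ_law hZ_indep ha hmono htail hr hc
  have haleph : νl.1 (Subtype.val ⁻¹'
      {x : Fin d → ℝ≥0∞ | ENNReal.ofReal 1 ≤ kthLargest l x}) = 1 := by
    rw [ENNReal.ofReal_one]
    exact hνl
  have hkpos : ∀ᶠ x in probFilter P, 0 < k x.1 :=
    (hk.comp (tendsto_fst_probFilter P)).eventually_gt_atTop 0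
  have hlow : ∀ p : ℝ≥0∞, 0 < p → p < 1 →
      1 < νl.1 (Subtype.val ⁻¹' {x : Fin d → ℝ≥0∞ | p ≤ kthLargest l x}) := by
    intro p hp0 hp1
    have hp : p ≠ ∞ := hp1.ne_top
    have := hRV.one_lt_measure_le_kthLargest hl1 ha hbl (p := p.toReal) (q := 1)
      (ENNReal.toReal_pos hp0.ne' hp)
      (by simpa using (ENNReal.toReal_lt_toReal hp ENNReal.one_ne_top).2 hp1) haleph.ge
    rwa [ENNReal.ofReal_toReal hp] at this
  -- Mass at least one above `q > 1` would make the mass at level one exceed `1`, against the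
  -- normalization of `ν⁽ˡ⁾`.
  have hupp : ∀ q : ℝ≥0∞, 1 < q →
      νl.1 (Subtype.val ⁻¹' {x : Fin d → ℝ≥0∞ | q < kthLargest l x}) < 1 := by
    intro q hq
    obtain ⟨s, hs1, hsq⟩ := ENNReal.lt_iff_exists_nnreal_btwn.1 hq
    by_contra! hge
    have := hRV.one_lt_measure_le_kthLargest hl1 ha hbl (p := 1) (q := s) one_pos
      (by exact_mod_cast hs1) (hge.trans (measure_mono fun x hx => by
        simp only [mem_preimage, mem_ofPred_eq, ENNReal.ofReal_coe_nnreal] at hx ⊢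
        exact (hsq.trans hx).le))
    exact absurd this (not_lt.2 haleph.le)
  set X : (Σ x : ℕ × Ω, Fin x.1) → Fin d → ℝ≥0∞ :=
    fun y => scaledPoint a (r y.1.1) (Z y.2 y.1.2)
  set W : (Σ x : ℕ × Ω, Fin x.1) → Fin d → ℝ≥0∞ := fun y j =>
    ENNReal.ofReal (y.1.1 / r y.1.1) * invRank (fun i : Fin y.1.1 => Z i y.1.2) y.2 j with hWdef
  set c : ℕ × Ω → ℝ≥0∞ :=
    fun x => kthLargest (k x.1) fun i : Fin x.1 => kthLargest l (W ⟨x, i⟩) with hcdef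
  have hone : Tendsto c (probFilter P) (𝓝 1) :=
    tendsto_kthLargest_of_asympEq (X := X) hl1 (k := fun x : ℕ × Ω => k x.1) hkpos hX hnear
      hlow hupp
  have hfinal := tendsto_traceOn_pointMeasure_of_asympEq (X := X) hl1
    (c := fun x : ℕ × Ω => (k x.1 : ℝ≥0)) hX
    (hnear.div_of_tendsto_one (c := fun y => c y.1) (hone.comp tendsto_comap))
  refine tendstoInDistribution_const_of_tendsto_probFilter P _ (fun n => ?_) νl
    (hfinal.congr' ?_)
  · exact (measurable_rankEstimator l (k n)).comp_aemeasurable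
      (aemeasurable_pi_lambda _ fun i : Fin n => (hZ_law i).aemeasurable)
  -- Order statistics are homogeneous, so the factor `n/r_n` cancels as soon as it is positive.
  · filter_upwards [(hc.comp (tendsto_fst_probFilter P)).eventually_gt_atTop 0] with x hx
    have hx0 : ENNReal.ofReal (x.1 / r x.1) ≠ 0 := (ENNReal.ofReal_pos.2 hx).ne'
    have hcx : c x = ENNReal.ofReal (x.1 / r x.1) *
        rankOrderStat l (k x.1) fun i : Fin x.1 => Z i x.2 := by
      simp only [hcdef, hWdef, kthLargest_const_mul _ _ hx0 ENNReal.ofReal_ne_top]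
      rfl
    simp only [hcx, hWdef, ENNReal.mul_div_mul_left _ _ hx0 ENNReal.ofReal_ne_top]
    rfl
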